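/- Throughout, 2-categories are weak (bicategories), 2-functors are pseudofunctors, 2-transformations are pseudonatural transformations, and $\mathcal{B}^{1\mathrm{op}}$ is $\mathcal{B}$ with its 1-morphisms reversed. A symmetric monoidal 2-category $\mathcal{B}$, with tensor product $\otimes$, unit $1$ and braiding $\beta$, is *0-closed* if for every $a \in \mathcal{B}$ the 2-functor $(-)\otimes a \colon \mathcal{B} \to \mathcal{B}$ has a right adjoint $b \mapsto b^a$; that is, there are 1-morphisms $\mathrm{ev}_a^b \colon b^a \otimes a \to b$ such that $Y \mapsto \mathrm{ev}_a^b \circ (Y \otimes a)$ is an equivalence of categories $\mathrm{Hom}(c, b^a) \simeq \mathrm{Hom}(c \otimes a, b)$ for every $c$. A *lax 1-contravariant $\mathrm{O}(1)$-volutive structure* on a 2-category $\mathcal{B}$ consists of a 2-functor $d \colon \mathcal{B} \to \mathcal{B}^{1\mathrm{op}}$, a 2-transformation $\eta \colon \mathrm{id} \to d^{1\mathrm{op}} \circ d$ (not required to be invertible), and an invertible modification $\tau$ with components $$\tau_a \colon d(\eta_a) \circ \eta_{d(a)} \Rightarrow \mathrm{id}_{d(a)},$$ such that for every $a$ the two 2-isomorphisms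 $$d(\eta_{d(a)}) \circ d(d(\eta_a)) \circ \eta_a \;\Longrightarrow\; \eta_a$$ agree: the one obtained by applying $d$ to $\tau_a$ (using the coherence 2-isomorphisms of $d$), and the one obtained from the naturality 2-isomorphism $d(d(\eta_a)) \circ \eta_a \cong \eta_{d(d(a))} \circ \eta_a$ followed by $\tau_{d(a)}$. **Proposition.** Let $\mathcal{B}$ be a 0-closed symmetric monoidal 2-category. Then $\mathcal{B}$ admits a lax 1-contravariant $\mathrm{O}(1)$-volutive structure $(d, \eta, \tau)$ such that: 1. $d = 1^{(-)}$: on objects $d(a) = 1^a$; for $X \colon a \to b$ the 1-morphism $d(X) = 1^X \colon 1^b \to 1^a$ is the one corresponding to $1^b \otimes a \xrightarrow{\mathrm{id} \otimes X} 1^b \otimes b \xrightarrow{\mathrm{ev}} 1$; for $f \colon X \Rightarrow Y$ the 2-morphism $d(f) = 1^f$ is the one corresponding to $\mathrm{ev} \circ (\mathrm{id} \otimes f)$; and the coherence 2-isomorphisms of $d$ correspond to those of the tensor product. 2. $\eta_a \colon a \to 1^{1^a}$ corresponds to $a \otimes 1^a \xrightarrow{\beta} 1^a \otimes a \xrightarrow{\mathrm{ev}}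 1$, i.e. $\mathrm{ev} \circ (\eta_a \otimes 1^a) \cong \mathrm{ev} \circ \beta_{a, 1^a}$. In particular, $\tau$ is an invertible modification with components $1^{\eta_a} \circ \eta_{1^a} \cong \mathrm{id}_{1^a}$. -/

import Mathlib

open CategoryTheory Bicategory Opposite
open Bicategory.Opposite
universe w v u w₁ v₁ u₁ w₂ v₂ u₂ w₃ v₃ u₃

namespace LaxVolutive

section General
variable {B : Type u} [Bicategory.{w, v} B] {C : Type u₁} [Bicategory.{w₁, v₁} C]
  {B' : Type u₂} [Bicategory.{w₂, v₂} B'] {C' : Type u₃} [Bicategory.{w₃, v₃} C']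

/-- Product of two 2-functors. -/
def prodMap (F : B ⥤ᵖ C) (G : B' ⥤ᵖ C') : B × B' ⥤ᵖ C × C' where
  obj x := (F.obj x.1, G.obj x.2)
  map f := (F.map f.1, G.map f.2)
  map₂ η := (F.map₂ η.1, G.map₂ η.2)
  map₂_id f := Prod.ext (F.map₂_id f.1) (G.map₂_id f.2)
  map₂_comp η θ := Prod.ext (F.map₂_comp η.1 θ.1) (G.map₂_comp η.2 θ.2)
  mapId x := Iso.prod (F.mapId x.1) (G.mapId x.2)
  mapComp f g := Iso.prod (F.mapComp f.1 g.1) (G.mapComp f.2 g.2)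
  map₂_whisker_left f _ _ η :=
    Prod.ext (F.map₂_whisker_left f.1 η.1) (G.map₂_whisker_left f.2 η.2)
  map₂_whisker_right η h :=
    Prod.ext (F.map₂_whisker_right η.1 h.1) (G.map₂_whisker_right η.2 h.2)
  map₂_associator f g h :=
    Prod.ext (F.map₂_associator f.1 g.1 h.1) (G.map₂_associator f.2 g.2 h.2)
  map₂_left_unitor f := Prod.ext (F.map₂_left_unitor f.1) (G.map₂_left_unitor f.2)
  map₂_right_unitor f := Prod.ext (F.map₂_right_unitor f.1) (G.map₂_right_unitor f.2)

/-- Reassociation of a threefold product of bicategories. -/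
def prodAssoc (B : Type u) [Bicategory.{w, v} B] : (B × B) × B ⥤ᵖ B × (B × B) where
  obj x := (x.1.1, (x.1.2, x.2))
  map f := (f.1.1, (f.1.2, f.2))
  map₂ η := (η.1.1, (η.1.2, η.2))
  mapId x := Iso.refl _
  mapComp f g := Iso.refl _
  map₂_id _ := rfl
  map₂_comp _ _ := rfl
  map₂_whisker_left f _ _ η := by
    refine Prod.ext ?_ (Prod.ext ?_ ?_) <;> simp
  map₂_whisker_right η h := by
    refine Prod.ext ?_ (Prod.ext ?_ ?_) <;> simp 
  map₂_associator f g h := by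
    refine Prod.ext ?_ (Prod.ext ?_ ?_) <;> simp 
  map₂_left_unitor f := by
    refine Prod.ext ?_ (Prod.ext ?_ ?_) <;> simp 
  map₂_right_unitor f := by
    refine Prod.ext ?_ (Prod.ext ?_ ?_) <;> simp 

/-- `F : B ⟶ C^{1op}` regarded as a 2-functor `F^{1op} : B^{1op} ⟶ C`. -/
def opToCov (F : B ⥤ᵖ Cᵒᵖ) : Bᵒᵖ ⥤ᵖ C where
  obj a := (F.obj a.unop).unop
  map f := (F.map f.unop).unop
  map₂ η := (F.map₂ η.unop2).unop2
  map₂_id f := by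
    simp
  map₂_comp η θ := by
    simp
  mapId a := (F.mapId a.unop).unop2
  mapComp f g := (F.mapComp g.unop f.unop).unop2
  map₂_whisker_left f _ _ η := congrArg Hom2.unop2 (F.map₂_whisker_right η.unop2 f.unop)
  map₂_whisker_right η h := congrArg Hom2.unop2 (F.map₂_whisker_left h.unop η.unop2)
  map₂_associator f g h := by
    have key : F.map₂ (α_ h.unop g.unop f.unop).inv =
        (F.mapComp h.unop (g.unop ≫ f.unop)).hom ≫
          F.map h.unop ◁ (F.mapComp g.unop f.unop).hom ≫ (α_ _ _ _).inv ≫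
            (F.mapComp h.unop g.unop).inv ▷ F.map f.unop ≫
              (F.mapComp (h.unop ≫ g.unop) f.unop).inv := by
      rw [F.mapComp_assoc_right_hom_assoc]
      simp
    exact congrArg Hom2.unop2 key
  map₂_left_unitor f := congrArg Hom2.unop2 (F.map₂_right_unitor f.unop)
  map₂_right_unitor f := congrArg Hom2.unop2 (F.map₂_left_unitor f.unop)

/-- An adjoint equivalence with left adjoint `f`. -/
structure AdjEquiv {a b : B} (f : a ⟶ b) where
  inv : b ⟶ a
  adj : Bicategory.Adjunction f inv
  isIso_unit : IsIso adj.unit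
  isIso_counit : IsIso adj.counit

namespace AdjEquiv
noncomputable def unitIso {a b : B} {f : a ⟶ b} (e : AdjEquiv f) : 𝟙 a ≅ f ≫ e.inv :=
  have := e.isIso_unit
  asIso e.adj.unit
noncomputable def counitIso {a b : B} {f : a ⟶ b} (e : AdjEquiv f) : e.inv ≫ f ≅ 𝟙 b :=
  have := e.isIso_counit
  asIso e.adj.counit
def id (a : B) : AdjEquiv (𝟙 a) where
  inv := 𝟙 a
  adj := Bicategory.Adjunction.id a
  isIso_unit := by dsimp [Bicategory.Adjunction.id]; infer_instance
  isIso_counit := by dsimp [Bicategory.Adjunction.id]; infer_instance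
def comp {a b c : B} {f : a ⟶ b} {g : b ⟶ c} (e : AdjEquiv f) (e' : AdjEquiv g) :
    AdjEquiv (f ≫ g) where
  inv := e'.inv ≫ e.inv
  adj := e.adj.comp e'.adj
  isIso_unit := by
    have := e.isIso_unit; have := e'.isIso_unit
    simp only [Bicategory.Adjunction.comp, Bicategory.Adjunction.compUnit,
      Bicategory.Adjunction.compCounit, bicategoricalComp]
    infer_instance
  isIso_counit := by
    have := e.isIso_counit; have := e'.isIso_counit
    simp only [Bicategory.Adjunction.comp, Bicategory.Adjunction.compUnit,
      Bicategory.Adjunction.compCounit, bicategoricalComp]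
    infer_instance
def map (F : B ⥤ᵖ C) {a b : B} {f : a ⟶ b} (e : AdjEquiv f) : AdjEquiv (F.map f) where
  inv := F.map e.inv
  adj := F.mapAdjunction e.adj
  isIso_unit := by
    have := e.isIso_unit
    dsimp [Pseudofunctor.mapAdjunction]; infer_instance
  isIso_counit := by
    have := e.isIso_counit
    dsimp [Pseudofunctor.mapAdjunction]; infer_instance
def prod {a b : B} {a' b' : B'} {f : a ⟶ b} {g : a' ⟶ b'} (e : AdjEquiv f) (e' : AdjEquiv g) :
    AdjEquiv (B := B × B') (a := (a, a')) (b := (b, b')) (f, g) where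
  inv := (e.inv, e'.inv)
  adj :=
    { unit := (e.adj.unit, e'.adj.unit)
      counit := (e.adj.counit, e'.adj.counit)
      left_triangle := Prod.ext e.adj.left_triangle e'.adj.left_triangle
      right_triangle := Prod.ext e.adj.right_triangle e'.adj.right_triangle }
  isIso_unit := by
    have := e.isIso_unit; have := e'.isIso_unit
    exact (Iso.prod (asIso e.adj.unit) (asIso e'.adj.unit)).isIso_hom
  isIso_counit := by
    have := e.isIso_counit; have := e'.isIso_counit
    exact (Iso.prod (asIso e.adj.counit) (asIso e'.adj.counit)).isIso_hom
end AdjEquiv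

/-- Pasting of squares along the middle 1-morphism. -/
def sqComp {a b c a' b' c' : B} {f : a ⟶ a'} {g : b ⟶ b'} {h : c ⟶ c'} {p : a ⟶ b} {q : b ⟶ c}
    {p' : a' ⟶ b'} {q' : b' ⟶ c'} (S : f ≫ p' ≅ p ≫ g) (T : g ≫ q' ≅ q ≫ h) :
    f ≫ p' ≫ q' ≅ (p ≫ q) ≫ h :=
  (α_ f p' q').symm ≪≫ whiskerRightIso S q' ≪≫ α_ p g q' ≪≫ whiskerLeftIso p T ≪≫ (α_ p q h).symm

/-- The identity square on a 1-morphism. -/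
def sqId {a a' : B} (f : a ⟶ a') : f ≫ 𝟙 a' ≅ 𝟙 a ≫ f := ρ_ f ≪≫ (λ_ f).symm

/-- Squares of strong transformations `p`, `q` at `f` are compatible with 2-morphisms `m`, `m'`:
the naturality condition of a modification with components `m`, `m'`. -/
def IsModificationAt {a b a' b' : B} {f : a ⟶ a'} {g : b ⟶ b'} {p q : a ⟶ b} {p' q' : a' ⟶ b'}
    (P : f ≫ p' ≅ p ≫ g) (Q : f ≫ q' ≅ q ≫ g) (m : p ≅ q) (m' : p' ≅ q') : Prop :=
  f ◁ m'.hom ≫ Q.hom = P.hom ≫ m.hom ▷ g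

namespace AdjEquiv

/-- The square for chosen inverses obtained from a square for the equivalences. -/
noncomputable def sqInv {a b a' b' : B} {f : a ⟶ a'} {g : b ⟶ b'} {p : a ⟶ b} {p' : a' ⟶ b'}
    (e : AdjEquiv p) (e' : AdjEquiv p') (S : f ≫ p' ≅ p ≫ g) : g ≫ e'.inv ≅ e.inv ≫ f :=
  Iso.refl _ ≪⊗≫ whiskerRightIso e.counitIso.symm (g ≫ e'.inv) ≪⊗≫
    whiskerLeftIso e.inv (whiskerRightIso S.symm e'.inv) ≪⊗≫
      whiskerLeftIso (e.inv ≫ f) e'.unitIso.symm ≪⊗≫ Iso.refl _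

/-- Moving an equivalence from the left end of a composite to the other side. -/
noncomputable def moveLeft {a b c : B} {p : a ⟶ b} (e : AdjEquiv p) {q : b ⟶ c} {r : a ⟶ c}
    (θ : p ≫ q ≅ r) : q ≅ e.inv ≫ r :=
  Iso.refl _ ≪⊗≫ whiskerRightIso e.counitIso.symm q ≪⊗≫ whiskerLeftIso e.inv θ

/-- Moving an equivalence from the right end of a composite to the other side. -/
noncomputable def moveRight {a b c : B} {q : b ⟶ c} (e : AdjEquiv q) {p : a ⟶ b} {r : a ⟶ c}
    (θ : p ≫ q ≅ r) : p ≅ r ≫ e.inv :=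
  Iso.refl _ ≪⊗≫ whiskerLeftIso p e.unitIso ≪⊗≫ whiskerRightIso θ e.inv

/-- The 2-isomorphism between chosen inverses induced by a 2-isomorphism of equivalences. -/
noncomputable def conj {a b : B} {p q : a ⟶ b} (e : AdjEquiv p) (e' : AdjEquiv q) (θ : p ≅ q) :
    e.inv ≅ e'.inv :=
  Iso.refl _ ≪⊗≫ whiskerLeftIso e.inv e'.unitIso ≪⊗≫
    whiskerLeftIso e.inv (whiskerRightIso θ.symm e'.inv) ≪⊗≫
      whiskerRightIso e.counitIso e'.inv ≪⊗≫ Iso.refl _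

end AdjEquiv

end General


/-- A bicategory with a tensor product and a unit object, without any coherence. -/
class TensorBicategory (B : Type u) [Bicategory.{w, v} B] where
  tensor : B × B ⥤ᵖ B
  unit : B

section Tensor
variable {B : Type u} [Bicategory.{w, v} B] [TensorBicategory B]

/-- Tensor product of objects. -/
def tObj (a b : B) : B := TensorBicategory.tensor.obj (a, b)
infixr:70 " ⊠ " => tObj

variable (B) in
def tUnit : B := TensorBicategory.unit

/-- Tensor product of 1-morphisms. -/
def tHom {a a' b b' : B} (f : a ⟶ a') (g : b ⟶ b') : a ⊠ b ⟶ a' ⊠ b' :=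
  TensorBicategory.tensor.map (X := (a, b)) (Y := (a', b')) (f, g)
infixr:70 " ⊠₁ " => tHom

/-- Tensor product of 2-morphisms. -/
def tHom₂ {a a' b b' : B} {f f' : a ⟶ a'} {g g' : b ⟶ b'} (s : f ⟶ f') (t : g ⟶ g') :
    f ⊠₁ g ⟶ f' ⊠₁ g' :=
  TensorBicategory.tensor.map₂ (a := (a, b)) (b := (a', b')) (f := (f, g)) (g := (f', g')) (s, t)

def tIso {a a' b b' : B} {f f' : a ⟶ a'} {g g' : b ⟶ b'} (s : f ≅ f') (t : g ≅ g') :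
    f ⊠₁ g ≅ f' ⊠₁ g' :=
  TensorBicategory.tensor.map₂Iso (a := (a, b)) (b := (a', b')) (f := (f, g)) (g := (f', g'))
    (Iso.prod s t)

def tComp {a a' a'' b b' b'' : B} (f : a ⟶ a') (f' : a' ⟶ a'') (g : b ⟶ b') (g' : b' ⟶ b'') :
    (f ≫ f') ⊠₁ (g ≫ g') ≅ (f ⊠₁ g) ≫ (f' ⊠₁ g') :=
  TensorBicategory.tensor.mapComp (a := (a, b)) (b := (a', b')) (c := (a'', b'')) (f, g) (f', g')

def tId (a b : B) : 𝟙 a ⊠₁ 𝟙 b ≅ 𝟙 (a ⊠ b) := TensorBicategory.tensor.mapId (a, b)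

/-- Tensor product of squares. -/
def tSq {a b a' b' c d c' d' : B} {f : a ⟶ a'} {g : b ⟶ b'} {p : a ⟶ b} {p' : a' ⟶ b'}
    {h : c ⟶ c'} {k : d ⟶ d'} {q : c ⟶ d} {q' : c' ⟶ d'}
    (S : f ≫ p' ≅ p ≫ g) (T : h ≫ q' ≅ q ≫ k) :
    (f ⊠₁ h) ≫ (p' ⊠₁ q') ≅ (p ⊠₁ q) ≫ (g ⊠₁ k) :=
  (tComp f p' h q').symm ≪≫ tIso S T ≪≫ tComp p g q k

def tEquiv {a a' b b' : B} {f : a ⟶ a'} {g : b ⟶ b'} (e : AdjEquiv f) (e' : AdjEquiv g) :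
    AdjEquiv (f ⊠₁ g) :=
  (AdjEquiv.prod e e').map TensorBicategory.tensor

abbrev wl (a : B) {b b' : B} (f : b ⟶ b') : a ⊠ b ⟶ a ⊠ b' := 𝟙 a ⊠₁ f
abbrev wr {a a' : B} (f : a ⟶ a') (b : B) : a ⊠ b ⟶ a' ⊠ b := f ⊠₁ 𝟙 b
infixr:75 " ◁ₜ " => wl
infixl:75 " ▷ₜ " => wr

def wlIso (a : B) {b b' : B} {f g : b ⟶ b'} (s : f ≅ g) : a ◁ₜ f ≅ a ◁ₜ g := tIso (Iso.refl _) s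
def wrIso {a a' : B} {f g : a ⟶ a'} (s : f ≅ g) (b : B) : f ▷ₜ b ≅ g ▷ₜ b := tIso s (Iso.refl _)
def wlComp (a : B) {b b' b'' : B} (f : b ⟶ b') (g : b' ⟶ b'') :
    a ◁ₜ (f ≫ g) ≅ (a ◁ₜ f) ≫ (a ◁ₜ g) :=
  tIso (λ_ (𝟙 a)).symm (Iso.refl _) ≪≫ tComp (𝟙 a) (𝟙 a) f g
def wrComp {a a' a'' : B} (f : a ⟶ a') (g : a' ⟶ a'') (b : B) :
    (f ≫ g) ▷ₜ b ≅ (f ▷ₜ b) ≫ (g ▷ₜ b) :=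
  tIso (Iso.refl _) (λ_ (𝟙 b)).symm ≪≫ tComp f g (𝟙 b) (𝟙 b)

/-- The interchange 2-isomorphism of the tensor product. -/
def interchange {a a' b b' : B} (f : a ⟶ a') (g : b ⟶ b') :
    (f ▷ₜ b) ≫ (a' ◁ₜ g) ≅ (a ◁ₜ g) ≫ (f ▷ₜ b') :=
  (tComp f (𝟙 a') (𝟙 b) g).symm ≪≫ tIso (ρ_ f ≪≫ (λ_ f).symm) (λ_ g ≪≫ (ρ_ g).symm) ≪≫
    tComp (𝟙 a) f g (𝟙 b')

/-- The 2-functor `a ⊠ -`. -/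
def tensorLeft (a : B) : B ⥤ᵖ B :=
  (Bicategory.Prod.sectR a B).toPseudofunctor.comp TensorBicategory.tensor
/-- The 2-functor `- ⊠ a`. -/
def tensorRight (a : B) : B ⥤ᵖ B :=
  (Bicategory.Prod.sectL B a).toPseudofunctor.comp TensorBicategory.tensor

variable (B) in
def tensor₃Left : (B × B) × B ⥤ᵖ B :=
  (prodMap TensorBicategory.tensor (Pseudofunctor.id B)).comp TensorBicategory.tensor
variable (B) in
def tensor₃Right : (B × B) × B ⥤ᵖ B :=
  (prodAssoc B).comp
    ((prodMap (Pseudofunctor.id B) TensorBicategory.tensor).comp TensorBicategory.tensor)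
end Tensor

/-- Tensor product, unit object, associator and unitors (pseudonatural adjoint equivalences). -/
class MonoidalBicategoryData (B : Type u) [Bicategory.{w, v} B] extends TensorBicategory B where
  assocTrans : (tensor₃Left B).StrongTrans (tensor₃Right B)
  assocTransEquiv (x : (B × B) × B) : AdjEquiv (assocTrans.app x)
  leftUnitTrans : (tensorLeft (tUnit B)).StrongTrans (Pseudofunctor.id B)
  leftUnitTransEquiv (a : B) : AdjEquiv (leftUnitTrans.app a)
  rightUnitTrans : (tensorRight (tUnit B)).StrongTrans (Pseudofunctor.id B)
  rightUnitTransEquiv (a : B) : AdjEquiv (rightUnitTrans.app a)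

section Data
variable {B : Type u} [Bicategory.{w, v} B] [MonoidalBicategoryData B]
open MonoidalBicategoryData

def asc (a b c : B) : (a ⊠ b) ⊠ c ⟶ a ⊠ (b ⊠ c) := assocTrans.app ((a, b), c)

def ascEquiv (a b c : B) : AdjEquiv (asc a b c) := assocTransEquiv ((a, b), c)

def ascInv (a b c : B) : a ⊠ (b ⊠ c) ⟶ (a ⊠ b) ⊠ c := (ascEquiv a b c).inv

/-- The naturality square of the associator. -/
def ascSq {a a' b b' c c' : B} (f : a ⟶ a') (g : b ⟶ b') (h : c ⟶ c') :
    ((f ⊠₁ g) ⊠₁ h) ≫ asc a' b' c' ≅ asc a b c ≫ (f ⊠₁ (g ⊠₁ h)) :=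
  assocTrans.naturality (a := ((a, b), c)) (b := ((a', b'), c')) ((f, g), h)

noncomputable def ascInvSq {a a' b b' c c' : B} (f : a ⟶ a') (g : b ⟶ b') (h : c ⟶ c') :
    (f ⊠₁ (g ⊠₁ h)) ≫ ascInv a' b' c' ≅ ascInv a b c ≫ ((f ⊠₁ g) ⊠₁ h) :=
  (ascEquiv a b c).sqInv (ascEquiv a' b' c') (ascSq f g h)

def lun (a : B) : tUnit B ⊠ a ⟶ a := leftUnitTrans.app a
def lunSq {a a' : B} (f : a ⟶ a') : (tUnit B ◁ₜ f) ≫ lun a' ≅ lun a ≫ f := leftUnitTrans.naturality f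
def run (a : B) : a ⊠ tUnit B ⟶ a := rightUnitTrans.app a
def runSq {a a' : B} (f : a ⟶ a') : (f ▷ₜ tUnit B) ≫ run a' ≅ run a ≫ f :=
  rightUnitTrans.naturality f

def ascNatL {a a' : B} (f : a ⟶ a') (b c : B) :
    asc a b c ≫ (f ▷ₜ (b ⊠ c)) ≅ ((f ▷ₜ b) ▷ₜ c) ≫ asc a' b c :=
  asc a b c ◁ᵢ tIso (Iso.refl f) (tId b c).symm ≪≫ (ascSq f (𝟙 b) (𝟙 c)).symm
def ascNatM (a : B) {b b' : B} (f : b ⟶ b') (c : B) :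
    asc a b c ≫ (a ◁ₜ (f ▷ₜ c)) ≅ ((a ◁ₜ f) ▷ₜ c) ≫ asc a b' c :=
  (ascSq (𝟙 a) f (𝟙 c)).symm
def ascNatR (a b : B) {c c' : B} (f : c ⟶ c') :
    asc a b c ≫ (a ◁ₜ (b ◁ₜ f)) ≅ ((a ⊠ b) ◁ₜ f) ≫ asc a b c' :=
  (ascSq (𝟙 a) (𝟙 b) f).symm ≪≫ tIso (tId a b) (Iso.refl f) ▷ᵢ asc a b c'

noncomputable def ascInvNatL {a a' : B} (f : a ⟶ a') (b c : B) :
    ascInv a b c ≫ ((f ▷ₜ b) ▷ₜ c) ≅ (f ▷ₜ (b ⊠ c)) ≫ ascInv a' b c :=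
  (ascInvSq f (𝟙 b) (𝟙 c)).symm ≪≫ tIso (Iso.refl f) (tId b c) ▷ᵢ ascInv a' b c
noncomputable def ascInvNatM (a : B) {b b' : B} (f : b ⟶ b') (c : B) :
    ascInv a b c ≫ ((a ◁ₜ f) ▷ₜ c) ≅ (a ◁ₜ (f ▷ₜ c)) ≫ ascInv a b' c :=
  (ascInvSq (𝟙 a) f (𝟙 c)).symm
noncomputable def ascInvNatR (a b : B) {c c' : B} (f : c ⟶ c') :
    ascInv a b c ≫ ((a ⊠ b) ◁ₜ f) ≅ (a ◁ₜ (b ◁ₜ f)) ≫ ascInv a b c' :=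
  ascInv a b c ◁ᵢ tIso (tId a b).symm (Iso.refl f) ≪≫ (ascInvSq (𝟙 a) (𝟙 b) f).symm

variable (B) in
/-- Families of 2-isomorphisms with the type of a pentagonator. -/
abbrev PentagonFamily := ∀ a b c d : B,
  (asc a b c ▷ₜ d) ≫ asc a (b ⊠ c) d ≫ (a ◁ₜ asc b c d) ≅ asc (a ⊠ b) c d ≫ asc a b (c ⊠ d)
variable (B) in
abbrev MiddleFamily := ∀ a b : B, asc a (tUnit B) b ≫ (a ◁ₜ lun b) ≅ run a ▷ₜ b
variable (B) in
abbrev LeftFamily := ∀ a b : B, lun a ▷ₜ b ≅ asc (tUnit B) a b ≫ lun (a ⊠ b)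
variable (B) in
abbrev RightFamily := ∀ a b : B, run (a ⊠ b) ≅ asc a b (tUnit B) ≫ (a ◁ₜ run b)

/-- One composite of the faces of the associahedron `K₅`. -/
def associahedron₁ (π : PentagonFamily B) (a b c d e : B) :
    ((asc a b c ▷ₜ d) ▷ₜ e) ≫ (asc a (b ⊠ c) d ▷ₜ e) ≫ ((a ◁ₜ asc b c d) ▷ₜ e) ≫
      asc a (b ⊠ (c ⊠ d)) e ≫ (a ◁ₜ asc b (c ⊠ d) e) ≫ (a ◁ₜ (b ◁ₜ asc c d e)) ≅
    asc ((a ⊠ b) ⊠ c) d e ≫ asc (a ⊠ b) c (d ⊠ e) ≫ asc a b (c ⊠ (d ⊠ e)) :=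
  Iso.refl _ ≪⊗≫
  (_ ◁ᵢ (wrComp _ _ e).symm ≪≫ (wrComp _ _ e).symm ≪≫ wrIso (π a b c d) e ≪≫ wrComp _ _ e) ▷ᵢ
    (asc a (b ⊠ (c ⊠ d)) e ≫ (a ◁ₜ asc b (c ⊠ d) e) ≫ (a ◁ₜ (b ◁ₜ asc c d e))) ≪⊗≫
  (asc (a ⊠ b) c d ▷ₜ e) ◁ᵢ π a b (c ⊠ d) e ▷ᵢ (a ◁ₜ (b ◁ₜ asc c d e)) ≪⊗≫
  ((asc (a ⊠ b) c d ▷ₜ e) ≫ asc (a ⊠ b) (c ⊠ d) e) ◁ᵢ ascNatR a b (asc c d e) ≪⊗≫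
  π (a ⊠ b) c d e ▷ᵢ asc a b (c ⊠ (d ⊠ e)) ≪⊗≫ Iso.refl _

/-- The other composite of the faces of the associahedron `K₅`. -/
def associahedron₂ (π : PentagonFamily B) (a b c d e : B) :
    ((asc a b c ▷ₜ d) ▷ₜ e) ≫ (asc a (b ⊠ c) d ▷ₜ e) ≫ ((a ◁ₜ asc b c d) ▷ₜ e) ≫
      asc a (b ⊠ (c ⊠ d)) e ≫ (a ◁ₜ asc b (c ⊠ d) e) ≫ (a ◁ₜ (b ◁ₜ asc c d e)) ≅
    asc ((a ⊠ b) ⊠ c) d e ≫ asc (a ⊠ b) c (d ⊠ e) ≫ asc a b (c ⊠ (d ⊠ e)) :=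
  Iso.refl _ ≪⊗≫
  (((asc a b c ▷ₜ d) ▷ₜ e) ≫ (asc a (b ⊠ c) d ▷ₜ e)) ◁ᵢ (ascNatM a (asc b c d) e).symm ▷ᵢ
    ((a ◁ₜ asc b (c ⊠ d) e) ≫ (a ◁ₜ (b ◁ₜ asc c d e))) ≪⊗≫
  (((asc a b c ▷ₜ d) ▷ₜ e) ≫ (asc a (b ⊠ c) d ▷ₜ e) ≫ asc a ((b ⊠ c) ⊠ d) e) ◁ᵢ
    (_ ◁ᵢ (wlComp a _ _).symm ≪≫ (wlComp a _ _).symm ≪≫ wlIso a (π b c d e) ≪≫ wlComp a _ _) ≪⊗≫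
  ((asc a b c ▷ₜ d) ▷ₜ e) ◁ᵢ π a (b ⊠ c) d e ▷ᵢ (a ◁ₜ asc b c (d ⊠ e)) ≪⊗≫
  (ascNatL (asc a b c) d e).symm ▷ᵢ (asc a (b ⊠ c) (d ⊠ e) ≫ (a ◁ₜ asc b c (d ⊠ e))) ≪⊗≫
  asc ((a ⊠ b) ⊠ c) d e ◁ᵢ π a b c (d ⊠ e) ≪⊗≫ Iso.refl _

/-- First composite in the left normalization axiom (unit in the second of four factors). -/
def leftNormalization₁ (μ : MiddleFamily B) (lam : LeftFamily B) (a b c : B) :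
    (asc a (tUnit B) b ▷ₜ c) ≫ asc a (tUnit B ⊠ b) c ≫ (a ◁ₜ asc (tUnit B) b c) ≫
      (a ◁ₜ lun (b ⊠ c)) ≅ ((run a ▷ₜ b) ▷ₜ c) ≫ asc a b c :=
  Iso.refl _ ≪⊗≫
  ((asc a (tUnit B) b ▷ₜ c) ≫ asc a (tUnit B ⊠ b) c) ◁ᵢ
    ((wlComp a _ _).symm ≪≫ wlIso a (lam b c).symm) ≪⊗≫
  (asc a (tUnit B) b ▷ₜ c) ◁ᵢ ascNatM a (lun b) c ≪⊗≫
  ((wrComp _ _ c).symm ≪≫ wrIso (μ a b) c) ▷ᵢ asc a b c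

/-- Second composite in the left normalization axiom. -/
def leftNormalization₂ (π : PentagonFamily B) (μ : MiddleFamily B) (a b c : B) :
    (asc a (tUnit B) b ▷ₜ c) ≫ asc a (tUnit B ⊠ b) c ≫ (a ◁ₜ asc (tUnit B) b c) ≫
      (a ◁ₜ lun (b ⊠ c)) ≅ ((run a ▷ₜ b) ▷ₜ c) ≫ asc a b c :=
  Iso.refl _ ≪⊗≫
  π a (tUnit B) b c ▷ᵢ (a ◁ₜ lun (b ⊠ c)) ≪⊗≫
  asc (a ⊠ tUnit B) b c ◁ᵢ μ a (b ⊠ c) ≪⊗≫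
  ascNatL (run a) b c

/-- First composite in the right normalization axiom (unit in the third of four factors). -/
def rightNormalization₁ (μ : MiddleFamily B) (rho : RightFamily B) (a b c : B) :
    (asc a b (tUnit B) ▷ₜ c) ≫ asc a (b ⊠ tUnit B) c ≫ (a ◁ₜ asc b (tUnit B) c) ≫
      (a ◁ₜ (b ◁ₜ lun c)) ≅ (run (a ⊠ b) ▷ₜ c) ≫ asc a b c :=
  Iso.refl _ ≪⊗≫
  ((asc a b (tUnit B) ▷ₜ c) ≫ asc a (b ⊠ tUnit B) c) ◁ᵢ
    ((wlComp a _ _).symm ≪≫ wlIso a (μ b c)) ≪⊗≫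
  (asc a b (tUnit B) ▷ₜ c) ◁ᵢ ascNatM a (run b) c ≪⊗≫
  ((wrComp _ _ c).symm ≪≫ wrIso (rho a b).symm c) ▷ᵢ asc a b c

/-- Second composite in the right normalization axiom. -/
def rightNormalization₂ (π : PentagonFamily B) (μ : MiddleFamily B) (a b c : B) :
    (asc a b (tUnit B) ▷ₜ c) ≫ asc a (b ⊠ tUnit B) c ≫ (a ◁ₜ asc b (tUnit B) c) ≫
      (a ◁ₜ (b ◁ₜ lun c)) ≅ (run (a ⊠ b) ▷ₜ c) ≫ asc a b c :=
  Iso.refl _ ≪⊗≫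
  π a b (tUnit B) c ▷ᵢ (a ◁ₜ (b ◁ₜ lun c)) ≪⊗≫
  asc (a ⊠ b) (tUnit B) c ◁ᵢ ascNatR a b (lun c) ≪⊗≫
  μ (a ⊠ b) c ▷ᵢ asc a b c

end Data

/-- Monoidal bicategories (weak monoidal 2-categories): pentagonator and 2-unitors are invertible
modifications, subject to the associahedron axiom and the two normalization axioms. -/
class MonoidalBicategory (B : Type u) [Bicategory.{w, v} B] extends MonoidalBicategoryData B where
  pentagonator : PentagonFamily B
  pentagonator_natural {a a' b b' c c' d d' : B} (f : a ⟶ a') (g : b ⟶ b') (h : c ⟶ c')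
    (k : d ⟶ d') :
    IsModificationAt
      (sqComp (tSq (ascSq f g h) (sqId k))
        (sqComp (ascSq f (g ⊠₁ h) k) (tSq (sqId f) (ascSq g h k))))
      (sqComp (ascSq (f ⊠₁ g) h k) (ascSq f g (h ⊠₁ k)))
      (pentagonator a b c d) (pentagonator a' b' c' d')
  middleUnitor : MiddleFamily B
  middleUnitor_natural {a a' b b' : B} (f : a ⟶ a') (g : b ⟶ b') :
    IsModificationAt
      (sqComp (ascSq f (𝟙 (tUnit B)) g) (tSq (sqId f) (lunSq g)))
      (tSq (runSq f) (sqId g)) (middleUnitor a b) (middleUnitor a' b')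
  leftTwoUnitor : LeftFamily B
  leftTwoUnitor_natural {a a' b b' : B} (f : a ⟶ a') (g : b ⟶ b') :
    IsModificationAt (tSq (lunSq f) (sqId g))
      (sqComp (ascSq (𝟙 (tUnit B)) f g) (lunSq (f ⊠₁ g)))
      (leftTwoUnitor a b) (leftTwoUnitor a' b')
  rightTwoUnitor : RightFamily B
  rightTwoUnitor_natural {a a' b b' : B} (f : a ⟶ a') (g : b ⟶ b') :
    IsModificationAt (runSq (f ⊠₁ g))
      (sqComp (ascSq f g (𝟙 (tUnit B))) (tSq (sqId f) (runSq g)))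
      (rightTwoUnitor a b) (rightTwoUnitor a' b')
  associahedron (a b c d e : B) :
    associahedron₁ pentagonator a b c d e = associahedron₂ pentagonator a b c d e
  left_normalization (a b c : B) :
    leftNormalization₁ middleUnitor leftTwoUnitor a b c =
      leftNormalization₂ pentagonator middleUnitor a b c
  right_normalization (a b c : B) :
    rightNormalization₁ middleUnitor rightTwoUnitor a b c =
      rightNormalization₂ pentagonator middleUnitor a b c

/-- A braiding 1-morphism: a pseudonatural adjoint equivalence `a ⊠ b ⟶ b ⊠ a`. -/
class BraidingData (B : Type u) [Bicategory.{w, v} B] extends MonoidalBicategory B where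
  braiding : (TensorBicategory.tensor (B := B)).StrongTrans
    ((Bicategory.Prod.swap B B).toPseudofunctor.comp TensorBicategory.tensor)
  braidingEquiv (x : B × B) : AdjEquiv (braiding.app x)

section Braiding
variable {B : Type u} [Bicategory.{w, v} B] [BraidingData B]

def br (a b : B) : a ⊠ b ⟶ b ⊠ a := BraidingData.braiding.app (a, b)

/-- The naturality square of the braiding. -/
def brSq {a a' b b' : B} (f : a ⟶ a') (g : b ⟶ b') :
    (f ⊠₁ g) ≫ br a' b' ≅ br a b ≫ (g ⊠₁ f) :=
  BraidingData.braiding.naturality (a := (a, b)) (b := (a', b')) (f, g)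

def brNatL {a a' : B} (f : a ⟶ a') (b : B) : (f ▷ₜ b) ≫ br a' b ≅ br a b ≫ (b ◁ₜ f) :=
  brSq f (𝟙 b)
def brNatR (a : B) {b b' : B} (f : b ⟶ b') : (a ◁ₜ f) ≫ br a b' ≅ br a b ≫ (f ▷ₜ a) :=
  brSq (𝟙 a) f

def pent (a b c d : B) :
    (asc a b c ▷ₜ d) ≫ asc a (b ⊠ c) d ≫ (a ◁ₜ asc b c d) ≅
      asc (a ⊠ b) c d ≫ asc a b (c ⊠ d) :=
  MonoidalBicategory.pentagonator a b c d

noncomputable def wlEquiv (a : B) {b b' : B} {f : b ⟶ b'} (e : AdjEquiv f) :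
    AdjEquiv (a ◁ₜ f) := tEquiv (AdjEquiv.id a) e
noncomputable def wrEquiv {a a' : B} {f : a ⟶ a'} (e : AdjEquiv f) (b : B) :
    AdjEquiv (f ▷ₜ b) := tEquiv e (AdjEquiv.id b)

/-- The pentagonator for the inverse associators. -/
noncomputable def pentInv (a b c d : B) :
    (a ◁ₜ ascInv b c d) ≫ ascInv a (b ⊠ c) d ≫ (ascInv a b c ▷ₜ d) ≅
      ascInv a b (c ⊠ d) ≫ ascInv (a ⊠ b) c d :=
  (α_ _ _ _).symm ≪≫
    AdjEquiv.conj
      ((wrEquiv (ascEquiv a b c) d).comp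
        ((ascEquiv a (b ⊠ c) d).comp (wlEquiv a (ascEquiv b c d))))
      ((ascEquiv (a ⊠ b) c d).comp (ascEquiv a b (c ⊠ d))) (pent a b c d)

/-- Mate of the pentagonator. -/
noncomputable def pentMate₁ (a b c d : B) :
    (ascInv a b c ▷ₜ d) ≫ asc (a ⊠ b) c d ≅
      asc a (b ⊠ c) d ≫ (a ◁ₜ asc b c d) ≫ ascInv a b (c ⊠ d) :=
  (ascEquiv a b (c ⊠ d)).moveRight
    (α_ _ _ _ ≪≫ ((wrEquiv (ascEquiv a b c) d).moveLeft (pent a b c d)).symm) ≪≫ α_ _ _ _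

/-- Mate of the pentagonator. -/
noncomputable def pentMate₂ (a b c d : B) :
    asc a b (c ⊠ d) ≫ (a ◁ₜ ascInv b c d) ≅
      ascInv (a ⊠ b) c d ≫ (asc a b c ▷ₜ d) ≫ asc a (b ⊠ c) d :=
  (ascEquiv (a ⊠ b) c d).moveLeft
    ((α_ _ _ _).symm ≪≫
      ((wlEquiv a (ascEquiv b c d)).moveRight (α_ _ _ _ ≪≫ pent a b c d)).symm)

/-- Mate of the pentagonator. -/
noncomputable def pentMate₃ (a b c d : B) :
    asc a (b ⊠ c) d ≫ (a ◁ₜ asc b c d) ≅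
      (ascInv a b c ▷ₜ d) ≫ asc (a ⊠ b) c d ≫ asc a b (c ⊠ d) :=
  (wrEquiv (ascEquiv a b c) d).moveLeft (pent a b c d)

variable (B) in
abbrev HexagonFamilyR := ∀ a b c : B,
  asc a b c ≫ br a (b ⊠ c) ≫ asc b c a ≅ (br a b ▷ₜ c) ≫ asc b a c ≫ (b ◁ₜ br a c)
variable (B) in
abbrev HexagonFamilyS := ∀ a b c : B,
  ascInv a b c ≫ br (a ⊠ b) c ≫ ascInv c a b ≅
    (a ◁ₜ br b c) ≫ ascInv a c b ≫ (br a c ▷ₜ b)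

noncomputable def ascUnit (a b c : B) : 𝟙 ((a ⊠ b) ⊠ c) ≅ asc a b c ≫ ascInv a b c :=
  (ascEquiv a b c).unitIso
noncomputable def ascCounit (a b c : B) : ascInv a b c ≫ asc a b c ≅ 𝟙 (a ⊠ (b ⊠ c)) :=
  (ascEquiv a b c).counitIso

/-- Moving `a` past `b`, `c`, `d`: first composite. -/
def crossing13₁ (R : HexagonFamilyR B) (a b c d : B) :
    ((br a b ▷ₜ c) ▷ₜ d) ≫ (asc b a c ▷ₜ d) ≫ ((b ◁ₜ br a c) ▷ₜ d) ≫ asc b (c ⊠ a) d ≫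
      (b ◁ₜ asc c a d) ≫ (b ◁ₜ (c ◁ₜ br a d)) ≅
    asc (a ⊠ b) c d ≫ asc a b (c ⊠ d) ≫ br a (b ⊠ (c ⊠ d)) ≫ asc b (c ⊠ d) a ≫
      (b ◁ₜ asc c d a) :=
  Iso.refl _ ≪⊗≫
  (_ ◁ᵢ (wrComp _ _ d).symm ≪≫ (wrComp _ _ d).symm ≪≫ wrIso (R a b c).symm d ≪≫
      wrComp _ _ d ≪≫ _ ◁ᵢ wrComp _ _ d) ▷ᵢ
    (asc b (c ⊠ a) d ≫ (b ◁ₜ asc c a d) ≫ (b ◁ₜ (c ◁ₜ br a d))) ≪⊗≫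
  ((asc a b c ▷ₜ d) ≫ (br a (b ⊠ c) ▷ₜ d)) ◁ᵢ pent b c a d ▷ᵢ (b ◁ₜ (c ◁ₜ br a d)) ≪⊗≫
  ((asc a b c ▷ₜ d) ≫ (br a (b ⊠ c) ▷ₜ d) ≫ asc (b ⊠ c) a d) ◁ᵢ ascNatR b c (br a d) ≪⊗≫
  (asc a b c ▷ₜ d) ◁ᵢ (R a (b ⊠ c) d).symm ▷ᵢ asc b c (d ⊠ a) ≪⊗≫
  ((asc a b c ▷ₜ d) ≫ asc a (b ⊠ c) d ≫ br a ((b ⊠ c) ⊠ d)) ◁ᵢ (pent b c d a).symm ≪⊗≫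
  ((asc a b c ▷ₜ d) ≫ asc a (b ⊠ c) d) ◁ᵢ (brNatR a (asc b c d)).symm ▷ᵢ
    (asc b (c ⊠ d) a ≫ (b ◁ₜ asc c d a)) ≪⊗≫
  pent a b c d ▷ᵢ (br a (b ⊠ (c ⊠ d)) ≫ asc b (c ⊠ d) a ≫ (b ◁ₜ asc c d a)) ≪⊗≫ Iso.refl _

/-- Moving `a` past `b`, `c`, `d`: second composite. -/
def crossing13₂ (R : HexagonFamilyR B) (a b c d : B) :
    ((br a b ▷ₜ c) ▷ₜ d) ≫ (asc b a c ▷ₜ d) ≫ ((b ◁ₜ br a c) ▷ₜ d) ≫ asc b (c ⊠ a) d ≫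
      (b ◁ₜ asc c a d) ≫ (b ◁ₜ (c ◁ₜ br a d)) ≅
    asc (a ⊠ b) c d ≫ asc a b (c ⊠ d) ≫ br a (b ⊠ (c ⊠ d)) ≫ asc b (c ⊠ d) a ≫
      (b ◁ₜ asc c d a) :=
  Iso.refl _ ≪⊗≫
  (((br a b ▷ₜ c) ▷ₜ d) ≫ (asc b a c ▷ₜ d)) ◁ᵢ (ascNatM b (br a c) d).symm ▷ᵢ
    ((b ◁ₜ asc c a d) ≫ (b ◁ₜ (c ◁ₜ br a d))) ≪⊗≫
  (((br a b ▷ₜ c) ▷ₜ d) ≫ (asc b a c ▷ₜ d) ≫ asc b (a ⊠ c) d) ◁ᵢ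
    (_ ◁ᵢ (wlComp b _ _).symm ≪≫ (wlComp b _ _).symm ≪≫ wlIso b (R a c d).symm ≪≫
      wlComp b _ _ ≪≫ _ ◁ᵢ wlComp b _ _) ≪⊗≫
  ((br a b ▷ₜ c) ▷ₜ d) ◁ᵢ pent b a c d ▷ᵢ ((b ◁ₜ br a (c ⊠ d)) ≫ (b ◁ₜ asc c d a)) ≪⊗≫
  (ascNatL (br a b) c d).symm ▷ᵢ
    (asc b a (c ⊠ d) ≫ (b ◁ₜ br a (c ⊠ d)) ≫ (b ◁ₜ asc c d a)) ≪⊗≫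
  asc (a ⊠ b) c d ◁ᵢ (R a b (c ⊠ d)).symm ▷ᵢ (b ◁ₜ asc c d a) ≪⊗≫ Iso.refl _

/-- Moving `a`, `b`, `c` past `d`: first composite. -/
noncomputable def crossing31₁ (S : HexagonFamilyS B) (a b c d : B) :
    (a ◁ₜ (b ◁ₜ br c d)) ≫ (a ◁ₜ ascInv b d c) ≫ (a ◁ₜ (br b d ▷ₜ c)) ≫ ascInv a (d ⊠ b) c ≫
      (ascInv a d b ▷ₜ c) ≫ ((br a d ▷ₜ b) ▷ₜ c) ≅
    ascInv a b (c ⊠ d) ≫ ascInv (a ⊠ b) c d ≫ br ((a ⊠ b) ⊠ c) d ≫ ascInv d (a ⊠ b) c ≫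
      (ascInv d a b ▷ₜ c) :=
  Iso.refl _ ≪⊗≫
  (_ ◁ᵢ (wlComp a _ _).symm ≪≫ (wlComp a _ _).symm ≪≫ wlIso a (S b c d).symm ≪≫
      wlComp a _ _ ≪≫ _ ◁ᵢ wlComp a _ _) ▷ᵢ
    (ascInv a (d ⊠ b) c ≫ (ascInv a d b ▷ₜ c) ≫ ((br a d ▷ₜ b) ▷ₜ c)) ≪⊗≫
  ((a ◁ₜ ascInv b c d) ≫ (a ◁ₜ br (b ⊠ c) d)) ◁ᵢ pentInv a d b c ▷ᵢ
    ((br a d ▷ₜ b) ▷ₜ c) ≪⊗≫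
  ((a ◁ₜ ascInv b c d) ≫ (a ◁ₜ br (b ⊠ c) d) ≫ ascInv a d (b ⊠ c)) ◁ᵢ
    ascInvNatL (br a d) b c ≪⊗≫
  (a ◁ₜ ascInv b c d) ◁ᵢ (S a (b ⊠ c) d).symm ▷ᵢ ascInv (d ⊠ a) b c ≪⊗≫
  ((a ◁ₜ ascInv b c d) ≫ ascInv a (b ⊠ c) d ≫ br (a ⊠ (b ⊠ c)) d) ◁ᵢ
    (pentInv d a b c).symm ≪⊗≫
  ((a ◁ₜ ascInv b c d) ≫ ascInv a (b ⊠ c) d) ◁ᵢ (brNatL (ascInv a b c) d).symm ▷ᵢ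
    (ascInv d (a ⊠ b) c ≫ (ascInv d a b ▷ₜ c)) ≪⊗≫
  pentInv a b c d ▷ᵢ (br ((a ⊠ b) ⊠ c) d ≫ ascInv d (a ⊠ b) c ≫ (ascInv d a b ▷ₜ c)) ≪⊗≫
  Iso.refl _

/-- Moving `a`, `b`, `c` past `d`: second composite. -/
noncomputable def crossing31₂ (S : HexagonFamilyS B) (a b c d : B) :
    (a ◁ₜ (b ◁ₜ br c d)) ≫ (a ◁ₜ ascInv b d c) ≫ (a ◁ₜ (br b d ▷ₜ c)) ≫ ascInv a (d ⊠ b) c ≫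
      (ascInv a d b ▷ₜ c) ≫ ((br a d ▷ₜ b) ▷ₜ c) ≅
    ascInv a b (c ⊠ d) ≫ ascInv (a ⊠ b) c d ≫ br ((a ⊠ b) ⊠ c) d ≫ ascInv d (a ⊠ b) c ≫
      (ascInv d a b ▷ₜ c) :=
  Iso.refl _ ≪⊗≫
  ((a ◁ₜ (b ◁ₜ br c d)) ≫ (a ◁ₜ ascInv b d c)) ◁ᵢ (ascInvNatM a (br b d) c).symm ▷ᵢ
    ((ascInv a d b ▷ₜ c) ≫ ((br a d ▷ₜ b) ▷ₜ c)) ≪⊗≫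
  ((a ◁ₜ (b ◁ₜ br c d)) ≫ (a ◁ₜ ascInv b d c) ≫ ascInv a (b ⊠ d) c) ◁ᵢ
    (_ ◁ᵢ (wrComp _ _ c).symm ≪≫ (wrComp _ _ c).symm ≪≫ wrIso (S a b d).symm c ≪≫
      wrComp _ _ c ≪≫ _ ◁ᵢ wrComp _ _ c) ≪⊗≫
  (a ◁ₜ (b ◁ₜ br c d)) ◁ᵢ pentInv a b d c ▷ᵢ ((br (a ⊠ b) d ▷ₜ c) ≫ (ascInv d a b ▷ₜ c)) ≪⊗≫
  (ascInvNatR a b (br c d)).symm ▷ᵢ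
    (ascInv (a ⊠ b) d c ≫ (br (a ⊠ b) d ▷ₜ c) ≫ (ascInv d a b ▷ₜ c)) ≪⊗≫
  ascInv a b (c ⊠ d) ◁ᵢ (S (a ⊠ b) c d).symm ▷ᵢ (ascInv d a b ▷ₜ c) ≪⊗≫ Iso.refl _

/-- `R` with one associator moved to the other side. -/
noncomputable def hexRight (R : HexagonFamilyR B) (a b c : B) :
    asc a b c ≫ br a (b ⊠ c) ≅
      (br a b ▷ₜ c) ≫ asc b a c ≫ (b ◁ₜ br a c) ≫ ascInv b c a :=
  (ascEquiv b c a).moveRight (α_ _ _ _ ≪≫ R a b c) ≪≫ α_ _ _ _ ≪≫ _ ◁ᵢ α_ _ _ _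

/-- `R` with one associator moved to the other side at the start. -/
noncomputable def hexLeft (R : HexagonFamilyR B) (a b c : B) :
    br a (b ⊠ c) ≫ asc b c a ≅
      ascInv a b c ≫ (br a b ▷ₜ c) ≫ asc b a c ≫ (b ◁ₜ br a c) :=
  (ascEquiv a b c).moveLeft (R a b c)

/-- `S` with one inverse associator cancelled at the end. -/
noncomputable def hexInvRight (S : HexagonFamilyS B) (a b c : B) :
    ascInv a b c ≫ br (a ⊠ b) c ≅
      (a ◁ₜ br b c) ≫ ascInv a c b ≫ (br a c ▷ₜ b) ≫ asc c a b :=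
  Iso.refl _ ≪⊗≫ (ascInv a b c ≫ br (a ⊠ b) c) ◁ᵢ (ascCounit c a b).symm ≪⊗≫
    S a b c ▷ᵢ asc c a b ≪⊗≫ Iso.refl _

/-- `S` with one inverse associator cancelled at the start. -/
noncomputable def hexInvLeft (S : HexagonFamilyS B) (a b c : B) :
    br (a ⊠ b) c ≫ ascInv c a b ≅
      asc a b c ≫ (a ◁ₜ br b c) ≫ ascInv a c b ≫ (br a c ▷ₜ b) :=
  Iso.refl _ ≪⊗≫ ascUnit a b c ▷ᵢ (br (a ⊠ b) c ≫ ascInv c a b) ≪⊗≫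
    asc a b c ◁ᵢ S a b c ≪⊗≫ Iso.refl _

/-- Moving `a`, `b` past `c`, `d`: first composite. -/
noncomputable def crossing22₁ (R : HexagonFamilyR B) (S : HexagonFamilyS B) (a b c d : B) :
    (ascInv a b c ▷ₜ d) ≫ (br (a ⊠ b) c ▷ₜ d) ≫ asc c (a ⊠ b) d ≫ (c ◁ₜ br (a ⊠ b) d) ≫
      (c ◁ₜ ascInv d a b) ≅
    ((a ◁ₜ br b c) ▷ₜ d) ≫ (ascInv a c b ▷ₜ d) ≫ asc (a ⊠ c) b d ≫ ((a ⊠ c) ◁ₜ br b d) ≫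
      (br a c ▷ₜ (d ⊠ b)) ≫ asc c a (d ⊠ b) ≫ (c ◁ₜ ascInv a d b) ≫ (c ◁ₜ (br a d ▷ₜ b)) :=
  Iso.refl _ ≪⊗≫
  (ascInv a b c ▷ₜ d) ◁ᵢ (R (a ⊠ b) c d).symm ▷ᵢ (c ◁ₜ ascInv d a b) ≪⊗≫
  pentMate₁ a b c d ▷ᵢ (br (a ⊠ b) (c ⊠ d) ≫ asc c d (a ⊠ b) ≫ (c ◁ₜ ascInv d a b)) ≪⊗≫
  (asc a (b ⊠ c) d ≫ (a ◁ₜ asc b c d) ≫ ascInv a b (c ⊠ d) ≫ br (a ⊠ b) (c ⊠ d)) ◁ᵢ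
    pentMate₂ c d a b ≪⊗≫
  (asc a (b ⊠ c) d ≫ (a ◁ₜ asc b c d)) ◁ᵢ S a b (c ⊠ d) ▷ᵢ
    ((asc c d a ▷ₜ b) ≫ asc c (d ⊠ a) b) ≪⊗≫
  asc a (b ⊠ c) d ◁ᵢ
    ((wlComp a _ _).symm ≪≫ wlIso a (hexRight R b c d) ≪≫ wlComp a _ _ ≪≫
      _ ◁ᵢ (wlComp a _ _ ≪≫ _ ◁ᵢ wlComp a _ _)) ▷ᵢ
    (ascInv a (c ⊠ d) b ≫ (br a (c ⊠ d) ▷ₜ b) ≫ (asc c d a ▷ₜ b) ≫ asc c (d ⊠ a) b) ≪⊗≫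
  (asc a (b ⊠ c) d ≫ (a ◁ₜ (br b c ▷ₜ d)) ≫ (a ◁ₜ asc c b d) ≫ (a ◁ₜ (c ◁ₜ br b d)) ≫
      (a ◁ₜ ascInv c d b) ≫ ascInv a (c ⊠ d) b) ◁ᵢ
    ((wrComp _ _ b).symm ≪≫ wrIso (hexLeft R a c d) b ≪≫ wrComp _ _ b ≪≫
      _ ◁ᵢ (wrComp _ _ b ≪≫ _ ◁ᵢ wrComp _ _ b)) ▷ᵢ asc c (d ⊠ a) b ≪⊗≫
  ascNatM a (br b c) d ▷ᵢ
    ((a ◁ₜ asc c b d) ≫ (a ◁ₜ (c ◁ₜ br b d)) ≫ (a ◁ₜ ascInv c d b) ≫ ascInv a (c ⊠ d) b ≫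
      (ascInv a c d ▷ₜ b) ≫ ((br a c ▷ₜ d) ▷ₜ b) ≫ (asc c a d ▷ₜ b) ≫
      ((c ◁ₜ br a d) ▷ₜ b) ≫ asc c (d ⊠ a) b) ≪⊗≫
  ((a ◁ₜ br b c) ▷ₜ d) ◁ᵢ
    pentMate₃ a c b d ▷ᵢ
    ((a ◁ₜ (c ◁ₜ br b d)) ≫ (a ◁ₜ ascInv c d b) ≫ ascInv a (c ⊠ d) b ≫
      (ascInv a c d ▷ₜ b) ≫ ((br a c ▷ₜ d) ▷ₜ b) ≫ (asc c a d ▷ₜ b) ≫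
      ((c ◁ₜ br a d) ▷ₜ b) ≫ asc c (d ⊠ a) b) ≪⊗≫
  (((a ◁ₜ br b c) ▷ₜ d) ≫ (ascInv a c b ▷ₜ d) ≫ asc (a ⊠ c) b d) ◁ᵢ
    ascNatR a c (br b d) ▷ᵢ
    ((a ◁ₜ ascInv c d b) ≫ ascInv a (c ⊠ d) b ≫
      (ascInv a c d ▷ₜ b) ≫ ((br a c ▷ₜ d) ▷ₜ b) ≫ (asc c a d ▷ₜ b) ≫
      ((c ◁ₜ br a d) ▷ₜ b) ≫ asc c (d ⊠ a) b) ≪⊗≫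
  (((a ◁ₜ br b c) ▷ₜ d) ≫ (ascInv a c b ▷ₜ d) ≫ asc (a ⊠ c) b d ≫ ((a ⊠ c) ◁ₜ br b d) ≫
      asc a c (d ⊠ b)) ◁ᵢ pentInv a c d b ▷ᵢ
    (((br a c ▷ₜ d) ▷ₜ b) ≫ (asc c a d ▷ₜ b) ≫ ((c ◁ₜ br a d) ▷ₜ b) ≫ asc c (d ⊠ a) b) ≪⊗≫
  (((a ◁ₜ br b c) ▷ₜ d) ≫ (ascInv a c b ▷ₜ d) ≫ asc (a ⊠ c) b d ≫ ((a ⊠ c) ◁ₜ br b d)) ◁ᵢ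
    (ascUnit a c (d ⊠ b)).symm ▷ᵢ
    (ascInv (a ⊠ c) d b ≫ ((br a c ▷ₜ d) ▷ₜ b) ≫ (asc c a d ▷ₜ b) ≫
      ((c ◁ₜ br a d) ▷ₜ b) ≫ asc c (d ⊠ a) b) ≪⊗≫
  (((a ◁ₜ br b c) ▷ₜ d) ≫ (ascInv a c b ▷ₜ d) ≫ asc (a ⊠ c) b d ≫ ((a ⊠ c) ◁ₜ br b d)) ◁ᵢ
    ascInvNatL (br a c) d b ▷ᵢ
    ((asc c a d ▷ₜ b) ≫ ((c ◁ₜ br a d) ▷ₜ b) ≫ asc c (d ⊠ a) b) ≪⊗≫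
  (((a ◁ₜ br b c) ▷ₜ d) ≫ (ascInv a c b ▷ₜ d) ≫ asc (a ⊠ c) b d ≫ ((a ⊠ c) ◁ₜ br b d) ≫
      (br a c ▷ₜ (d ⊠ b)) ≫ ascInv (c ⊠ a) d b ≫ (asc c a d ▷ₜ b)) ◁ᵢ
    (ascNatM c (br a d) b).symm ≪⊗≫
  (((a ◁ₜ br b c) ▷ₜ d) ≫ (ascInv a c b ▷ₜ d) ≫ asc (a ⊠ c) b d ≫ ((a ⊠ c) ◁ₜ br b d) ≫
      (br a c ▷ₜ (d ⊠ b))) ◁ᵢ (pentMate₂ c a d b).symm ▷ᵢ (c ◁ₜ (br a d ▷ₜ b)) ≪⊗≫ Iso.refl _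

/-- Moving `a`, `b` past `c`, `d`: second composite. -/
noncomputable def crossing22₂ (S : HexagonFamilyS B) (a b c d : B) :
    (ascInv a b c ▷ₜ d) ≫ (br (a ⊠ b) c ▷ₜ d) ≫ asc c (a ⊠ b) d ≫ (c ◁ₜ br (a ⊠ b) d) ≫
      (c ◁ₜ ascInv d a b) ≅
    ((a ◁ₜ br b c) ▷ₜ d) ≫ (ascInv a c b ▷ₜ d) ≫ asc (a ⊠ c) b d ≫ ((a ⊠ c) ◁ₜ br b d) ≫
      (br a c ▷ₜ (d ⊠ b)) ≫ asc c a (d ⊠ b) ≫ (c ◁ₜ ascInv a d b) ≫ (c ◁ₜ (br a d ▷ₜ b)) :=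
  Iso.refl _ ≪⊗≫
  ((wrComp _ _ d).symm ≪≫ wrIso (hexInvRight S a b c) d ≪≫ wrComp _ _ d ≪≫
      _ ◁ᵢ (wrComp _ _ d ≪≫ _ ◁ᵢ wrComp _ _ d)) ▷ᵢ
    (asc c (a ⊠ b) d ≫ (c ◁ₜ br (a ⊠ b) d) ≫ (c ◁ₜ ascInv d a b)) ≪⊗≫
  (((a ◁ₜ br b c) ▷ₜ d) ≫ (ascInv a c b ▷ₜ d) ≫ ((br a c ▷ₜ b) ▷ₜ d) ≫ (asc c a b ▷ₜ d) ≫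
      asc c (a ⊠ b) d) ◁ᵢ
    ((wlComp c _ _).symm ≪≫ wlIso c (hexInvLeft S a b d) ≪≫ wlComp c _ _ ≪≫
      _ ◁ᵢ (wlComp c _ _ ≪≫ _ ◁ᵢ wlComp c _ _)) ≪⊗≫
  (((a ◁ₜ br b c) ▷ₜ d) ≫ (ascInv a c b ▷ₜ d) ≫ ((br a c ▷ₜ b) ▷ₜ d)) ◁ᵢ pent c a b d ▷ᵢ
    ((c ◁ₜ (a ◁ₜ br b d)) ≫ (c ◁ₜ ascInv a d b) ≫ (c ◁ₜ (br a d ▷ₜ b))) ≪⊗≫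
  (((a ◁ₜ br b c) ▷ₜ d) ≫ (ascInv a c b ▷ₜ d)) ◁ᵢ (ascNatL (br a c) b d).symm ▷ᵢ
    (asc c a (b ⊠ d) ≫ (c ◁ₜ (a ◁ₜ br b d)) ≫ (c ◁ₜ ascInv a d b) ≫
      (c ◁ₜ (br a d ▷ₜ b))) ≪⊗≫
  (((a ◁ₜ br b c) ▷ₜ d) ≫ (ascInv a c b ▷ₜ d) ≫ asc (a ⊠ c) b d ≫ (br a c ▷ₜ (b ⊠ d))) ◁ᵢ
    ascNatR c a (br b d) ▷ᵢ ((c ◁ₜ ascInv a d b) ≫ (c ◁ₜ (br a d ▷ₜ b))) ≪⊗≫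
  (((a ◁ₜ br b c) ▷ₜ d) ≫ (ascInv a c b ▷ₜ d) ≫ asc (a ⊠ c) b d) ◁ᵢ
    interchange (br a c) (br b d) ▷ᵢ
    (asc c a (d ⊠ b) ≫ (c ◁ₜ ascInv a d b) ≫ (c ◁ₜ (br a d ▷ₜ b))) ≪⊗≫ Iso.refl _

/-- The hexagonal composite using `R` twice. -/
noncomputable def yangBaxter₁ (R : HexagonFamilyR B) (a b c : B) :
    (br a b ▷ₜ c) ≫ asc b a c ≫ (b ◁ₜ br a c) ≫ ascInv b c a ≫ (br b c ▷ₜ a) ≫ asc c b a ≅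
    asc a b c ≫ (a ◁ₜ br b c) ≫ ascInv a c b ≫ (br a c ▷ₜ b) ≫ asc c a b ≫ (c ◁ₜ br a b) :=
  Iso.refl _ ≪⊗≫
  (R a b c).symm ▷ᵢ (ascInv b c a ≫ (br b c ▷ₜ a) ≫ asc c b a) ≪⊗≫
  (asc a b c ≫ br a (b ⊠ c)) ◁ᵢ (ascUnit b c a).symm ▷ᵢ ((br b c ▷ₜ a) ≫ asc c b a) ≪⊗≫
  asc a b c ◁ᵢ (brNatR a (br b c)).symm ▷ᵢ asc c b a ≪⊗≫
  (asc a b c ≫ (a ◁ₜ br b c)) ◁ᵢ (ascCounit a c b).symm ▷ᵢ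
    (br a (c ⊠ b) ≫ asc c b a) ≪⊗≫
  (asc a b c ≫ (a ◁ₜ br b c) ≫ ascInv a c b) ◁ᵢ R a c b ≪⊗≫ Iso.refl _

/-- The hexagonal composite using `S` twice. -/
noncomputable def yangBaxter₂ (S : HexagonFamilyS B) (a b c : B) :
    (br a b ▷ₜ c) ≫ asc b a c ≫ (b ◁ₜ br a c) ≫ ascInv b c a ≫ (br b c ▷ₜ a) ≫ asc c b a ≅
    asc a b c ≫ (a ◁ₜ br b c) ≫ ascInv a c b ≫ (br a c ▷ₜ b) ≫ asc c a b ≫ (c ◁ₜ br a b) :=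
  Iso.refl _ ≪⊗≫
  ((br a b ▷ₜ c) ≫ asc b a c) ◁ᵢ (S b a c).symm ▷ᵢ asc c b a ≪⊗≫
  (br a b ▷ₜ c) ◁ᵢ (ascUnit b a c).symm ▷ᵢ (br (b ⊠ a) c ≫ ascInv c b a ≫ asc c b a) ≪⊗≫
  ((br a b ▷ₜ c) ≫ br (b ⊠ a) c) ◁ᵢ ascCounit c b a ≪⊗≫
  brNatL (br a b) c ≪⊗≫
  ascUnit a b c ▷ᵢ (br (a ⊠ b) c ≫ (c ◁ₜ br a b)) ≪⊗≫
  (asc a b c ≫ ascInv a b c ≫ br (a ⊠ b) c) ◁ᵢ (ascCounit c a b).symm ▷ᵢ (c ◁ₜ br a b) ≪⊗≫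
  asc a b c ◁ᵢ S a b c ▷ᵢ (asc c a b ≫ (c ◁ₜ br a b)) ≪⊗≫ Iso.refl _

end Braiding

/-- Braided monoidal bicategories: hexagonator modifications `R`, `S`, subject to the axioms for a string
crossing three strings, three strings crossing one, two crossing two, and the Yang-Baxter axiom. -/
class BraidedMonoidalBicategory (B : Type u) [Bicategory.{w, v} B] extends BraidingData B where
  hexagonR : HexagonFamilyR B
  hexagonR_natural {a a' b b' c c' : B} (f : a ⟶ a') (g : b ⟶ b') (h : c ⟶ c') :
    IsModificationAt
      (sqComp (ascSq f g h) (sqComp (brSq f (g ⊠₁ h)) (ascSq g h f)))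
      (sqComp (tSq (brSq f g) (sqId h)) (sqComp (ascSq g f h) (tSq (sqId g) (brSq f h))))
      (hexagonR a b c) (hexagonR a' b' c')
  hexagonS : HexagonFamilyS B
  hexagonS_natural {a a' b b' c c' : B} (f : a ⟶ a') (g : b ⟶ b') (h : c ⟶ c') :
    IsModificationAt
      (sqComp (ascInvSq f g h) (sqComp (brSq (f ⊠₁ g) h) (ascInvSq h f g)))
      (sqComp (tSq (sqId f) (brSq g h)) (sqComp (ascInvSq f h g) (tSq (brSq f h) (sqId g))))
      (hexagonS a b c) (hexagonS a' b' c')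
  crossing13 (a b c d : B) : crossing13₁ hexagonR a b c d = crossing13₂ hexagonR a b c d
  crossing31 (a b c d : B) : crossing31₁ hexagonS a b c d = crossing31₂ hexagonS a b c d
  crossing22 (a b c d : B) :
    crossing22₁ hexagonR hexagonS a b c d = crossing22₂ hexagonS a b c d
  yangBaxter (a b c : B) : yangBaxter₁ hexagonR a b c = yangBaxter₂ hexagonS a b c

section Syllepsis
variable {B : Type u} [Bicategory.{w, v} B] [BraidedMonoidalBicategory B]
open BraidedMonoidalBicategory

variable (B) in
abbrev SyllepsisFamily := ∀ a b : B, br a b ≫ br b a ≅ 𝟙 (a ⊠ b)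

noncomputable def syllepsisR₁ (s : SyllepsisFamily B) (a b c : B) :
    asc a b c ≫ br a (b ⊠ c) ≫ asc b c a ≫ ascInv b c a ≫ br (b ⊠ c) a ≫ ascInv a b c ≅
      𝟙 ((a ⊠ b) ⊠ c) :=
  Iso.refl _ ≪⊗≫
  (asc a b c ≫ br a (b ⊠ c)) ◁ᵢ (ascUnit b c a).symm ▷ᵢ (br (b ⊠ c) a ≫ ascInv a b c) ≪⊗≫
  asc a b c ◁ᵢ s a (b ⊠ c) ▷ᵢ ascInv a b c ≪⊗≫
  (ascUnit a b c).symm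

noncomputable def syllepsisR₂ (s : SyllepsisFamily B) (a b c : B) :
    asc a b c ≫ br a (b ⊠ c) ≫ asc b c a ≫ ascInv b c a ≫ br (b ⊠ c) a ≫ ascInv a b c ≅
      𝟙 ((a ⊠ b) ⊠ c) :=
  Iso.refl _ ≪⊗≫
  hexagonR a b c ▷ᵢ (ascInv b c a ≫ br (b ⊠ c) a ≫ ascInv a b c) ≪⊗≫
  ((br a b ▷ₜ c) ≫ asc b a c ≫ (b ◁ₜ br a c)) ◁ᵢ hexagonS b c a ≪⊗≫
  ((br a b ▷ₜ c) ≫ asc b a c) ◁ᵢ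
    ((wlComp b _ _).symm ≪≫ wlIso b (s a c) ≪≫ tId b (a ⊠ c)) ▷ᵢ
    (ascInv b a c ≫ (br b a ▷ₜ c)) ≪⊗≫
  (br a b ▷ₜ c) ◁ᵢ (ascUnit b a c).symm ▷ᵢ (br b a ▷ₜ c) ≪⊗≫
  ((wrComp _ _ c).symm ≪≫ wrIso (s a b) c ≪≫ tId (a ⊠ b) c)

noncomputable def syllepsisS₁ (s : SyllepsisFamily B) (a b c : B) :
    ascInv a b c ≫ br (a ⊠ b) c ≫ ascInv c a b ≫ asc c a b ≫ br c (a ⊠ b) ≫ asc a b c ≅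
      𝟙 (a ⊠ (b ⊠ c)) :=
  Iso.refl _ ≪⊗≫
  (ascInv a b c ≫ br (a ⊠ b) c) ◁ᵢ ascCounit c a b ▷ᵢ (br c (a ⊠ b) ≫ asc a b c) ≪⊗≫
  ascInv a b c ◁ᵢ s (a ⊠ b) c ▷ᵢ asc a b c ≪⊗≫
  ascCounit a b c

noncomputable def syllepsisS₂ (s : SyllepsisFamily B) (a b c : B) :
    ascInv a b c ≫ br (a ⊠ b) c ≫ ascInv c a b ≫ asc c a b ≫ br c (a ⊠ b) ≫ asc a b c ≅
      𝟙 (a ⊠ (b ⊠ c)) :=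
  Iso.refl _ ≪⊗≫
  hexagonS a b c ▷ᵢ (asc c a b ≫ br c (a ⊠ b) ≫ asc a b c) ≪⊗≫
  ((a ◁ₜ br b c) ≫ ascInv a c b ≫ (br a c ▷ₜ b)) ◁ᵢ hexagonR c a b ≪⊗≫
  ((a ◁ₜ br b c) ≫ ascInv a c b) ◁ᵢ
    ((wrComp _ _ b).symm ≪≫ wrIso (s a c) b ≪≫ tId (a ⊠ c) b) ▷ᵢ
    (asc a c b ≫ (a ◁ₜ br c b)) ≪⊗≫
  (a ◁ₜ br b c) ◁ᵢ ascCounit a c b ▷ᵢ (a ◁ₜ br c b) ≪⊗≫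
  ((wlComp a _ _).symm ≪≫ wlIso a (s b c) ≪≫ tId a (b ⊠ c))
end Syllepsis

/-- Sylleptic monoidal bicategories: the syllepsis is an invertible modification compatible with both
hexagonators. -/
class SyllepticMonoidalBicategory (B : Type u) [Bicategory.{w, v} B] extends
    BraidedMonoidalBicategory B where
  syllepsis : SyllepsisFamily B
  syllepsis_natural {a a' b b' : B} (f : a ⟶ a') (g : b ⟶ b') :
    IsModificationAt (sqComp (brSq f g) (brSq g f)) (sqId (f ⊠₁ g))
      (syllepsis a b) (syllepsis a' b')
  syllepsis_hexagonR (a b c : B) : syllepsisR₁ syllepsis a b c = syllepsisR₂ syllepsis a b c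
  syllepsis_hexagonS (a b c : B) : syllepsisS₁ syllepsis a b c = syllepsisS₂ syllepsis a b c

/-- Symmetric monoidal bicategories: the two 2-isomorphisms `β ∘ β ∘ β ⟶ β` built from the syllepsis
agree. -/
class SymmetricMonoidalBicategory (B : Type u) [Bicategory.{w, v} B] extends
    SyllepticMonoidalBicategory B where
  symmetry (a b : B) :
    br a b ◁ᵢ syllepsis b a ≪≫ ρ_ (br a b) =
      (α_ (br a b) (br b a) (br a b)).symm ≪≫ syllepsis a b ▷ᵢ br a b ≪≫ λ_ (br a b)

/-! ### Right adjoints of 2-functors and 0-closedness -/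

section Closed

/-- The functor `Hom(x, r) ⥤ Hom(F x, c)`, `f ↦ e ∘ F f`, induced by a 1-morphism `e : F r ⟶ c`. -/
def transposeFunctor {B : Type u} [Bicategory.{w, v} B] {C : Type u₁} [Bicategory.{w₁, v₁} C]
    (F : B ⥤ᵖ C) {r : B} {c : C} (e : F.obj r ⟶ c) (x : B) : (x ⟶ r) ⥤ (F.obj x ⟶ c) where
  obj f := F.map f ≫ e
  map θ := F.map₂ θ ▷ e

/-- A right adjoint of a 2-functor `F` (in the bicategorical sense): for every `c` an object `obj c`
and a counit component `F (obj c) ⟶ c` inducing equivalences of categories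
`Hom(x, obj c) ≌ Hom(F x, c)`; the action of the right adjoint on 1- and 2-morphisms, the unit and
the triangle modifications are determined by this data. -/
structure TwoFunctorRightAdjoint {B : Type u} [Bicategory.{w, v} B] {C : Type u₁}
    [Bicategory.{w₁, v₁} C] (F : B ⥤ᵖ C) where
  obj : C → B
  counit (c : C) : F.obj (obj c) ⟶ c
  isEquivalence (c : C) (x : B) : (transposeFunctor F (counit c) x).IsEquivalence

/-- A symmetric monoidal 2-category is 0-closed if every 2-functor `- ⊠ a` has a right adjoint. -/
class ZeroClosed (B : Type u) [Bicategory.{w, v} B] [SymmetricMonoidalBicategory B] where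
  rightAdjoint (a : B) : TwoFunctorRightAdjoint (tensorRight a)

variable {B : Type u} [Bicategory.{w, v} B] [SymmetricMonoidalBicategory B] [ZeroClosed B]

/-- The internal hom `b ^ a`. -/
def ihom (a b : B) : B := (ZeroClosed.rightAdjoint a).obj b

/-- The evaluation `b ^ a ⊠ a ⟶ b`. -/
def ihomEv (a b : B) : ihom a b ⊠ a ⟶ b := (ZeroClosed.rightAdjoint a).counit b

/-- A 2-functor `d : B ⥤ᵖ Bᵒᵖ` is `1 ^ (-)`: on objects it is `a ↦ 1 ^ a`; the 1-morphism `d X` is the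
one corresponding to `1 ^ b ⊠ a ⟶ 1 ^ b ⊠ b ⟶ 1` (witnessed by `mapIso X`), `d` of a 2-morphism is the
one corresponding to whiskering with it, and the coherence 2-isomorphisms of `d` are the ones
corresponding to the coherence 2-isomorphisms of the tensor product. -/
structure DualityFunctor (d : B ⥤ᵖ Bᵒᵖ) where
  ev (a : B) : (d.obj a).unop ⊠ a ⟶ tUnit B
  ev_eq (a : B) : (⟨(d.obj a).unop, ev a⟩ : Σ x : B, (x ⊠ a ⟶ tUnit B)) =
    ⟨ihom a (tUnit B), ihomEv a (tUnit B)⟩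
  mapIso {a b : B} (X : a ⟶ b) :
    ((d.map X).unop ▷ₜ a) ≫ ev a ≅ ((d.obj b).unop ◁ₜ X) ≫ ev b
  mapIso_natural {a b : B} {X Y : a ⟶ b} (f : X ⟶ Y) :
    tHom₂ (d.map₂ f).unop2 (𝟙 (𝟙 a)) ▷ ev a ≫ (mapIso Y).hom =
      (mapIso X).hom ≫ tHom₂ (𝟙 (𝟙 (d.obj b).unop)) f ▷ ev b
  mapIso_id (a : B) : mapIso (𝟙 a) = wrIso (d.mapId a).unop2 a ▷ᵢ ev a
  mapIso_comp {a b c : B} (X : a ⟶ b) (Y : b ⟶ c) :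
    mapIso (X ≫ Y) =
      (wrIso (d.mapComp X Y).unop2 a ≪≫ wrComp (d.map Y).unop (d.map X).unop a) ▷ᵢ ev a ≪≫
      α_ _ _ _ ≪≫ ((d.map Y).unop ▷ₜ a) ◁ᵢ mapIso X ≪≫ (α_ _ _ _).symm ≪≫
      interchange (d.map Y).unop X ▷ᵢ ev b ≪≫ α_ _ _ _ ≪≫
      ((d.obj c).unop ◁ₜ X) ◁ᵢ mapIso Y ≪≫ (α_ _ _ _).symm ≪≫
      (wlComp (d.obj c).unop X Y).symm ▷ᵢ ev c

end Closed

/-! ### Lax volutive structures -/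

/-- A lax 1-contravariant `O(1)`-volutive structure: a 2-functor `d : B ⥤ᵖ Bᵒᵖ`, a 2-transformation
`η : id ⟶ d ∘ d`, and an invertible modification `τ` from the transformation with components
`d (η a) ∘ η (d a) : d a ⟶ d a` to the identity, subject to one coherence condition: the two
2-isomorphisms from `d (η (d a)) ∘ d (d (η a)) ∘ η a` to `η a`, via `d (τ a)` and via naturality of `η`
followed by `τ (d a)`, agree. -/
structure LaxVolutiveStructure (B : Type u) [Bicategory.{w, v} B] where
  d : B ⥤ᵖ Bᵒᵖ
  η : (Pseudofunctor.id B).StrongTrans (d.comp (opToCov d))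
  τ (a : B) : η.app (d.obj a).unop ≫ (d.map (η.app a)).unop ≅ 𝟙 (d.obj a).unop
  τ_natural {a b : B} (f : a ⟶ b) :
    IsModificationAt
      (sqComp (η.naturality (d.map f).unop)
        ((d.mapComp (η.app a) ((d.comp (opToCov d)).map f)).unop2.symm ≪≫
          (d.map₂Iso (η.naturality f).symm).unop2 ≪≫
          (d.mapComp f (η.app b)).unop2))
      (sqId (d.map f).unop) (τ b) (τ a)
  coherence (a : B) :
    η.app a ◁ᵢ ((d.mapComp (η.app (d.obj a).unop) (d.map (η.app a)).unop).unop2.symm ≪≫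
        (d.map₂Iso (τ a)).unop2 ≪≫ (d.mapId (d.obj a).unop).unop2) =
    (α_ _ _ _).symm ≪≫ (η.naturality (η.app a)).symm ▷ᵢ (d.map (η.app (d.obj a).unop)).unop ≪≫
      α_ _ _ _ ≪≫ η.app a ◁ᵢ τ (d.obj a).unop

end LaxVolutive

/-! A 1-morphism into `1^a` amounts to a pairing `x ⊗ a → 1`, and 0-closedness makes this an
equivalence of hom-categories. So a 2-cell between 1-morphisms into a dual can be defined by naming
a 2-cell of pairings (`transposeIso`, `transposeHom`), and an equation of such 2-cells can be tested
after evaluation (`eq_of_act_comp_eq`). Everything becomes a calculus of 2-cells between pairings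
pulled back along some `f ⊗ g`, with three operations: 2-cells act on the arguments (`act`),
arguments are precomposed (`res`), and arguments are exchanged by the braiding (`flipHom`).

Write `⟨f, g⟩` for the evaluation pulled back along `f ⊗ g`. The basic moves are `slide`, `⟨dX f, g⟩
≅ ⟨f, X g⟩`, defining `d` on 1-morphisms, and `unitSlide`, `⟨η f, g⟩ ≅ ⟨g, f⟩` up to braiding,
defining `η`. Their braided forms are `coslide` and `counitSlide`, the latter completed by the
syllepsis to cancel a double braiding. All are natural in both arguments and compatible with
restriction, so identities verified at identity arguments hold at all arguments.

The structure 2-cells are then chains of moves. Naturality of `η` is `⟨ddX η f, g⟩ ≅ ⟨η f, dX g⟩ ≅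
⟨dX g, f⟩ ≅ ⟨g, X f⟩ ≅ ⟨η X f, g⟩`, and `τ` is `⟨dη η f, g⟩ ≅ ⟨η f, η g⟩ ≅ ⟨η g, f⟩ ≅ ⟨f, g⟩`. The
axioms of `d` come from sliding along composites (`slide_id`, `slide_comp`), those of `η` from
`act_unitNat_slide`. That `τ` is a modification rests on naturality of the syllepsis
(`coslide_counitSlide_slide`). The coherence condition for `τ` needs in addition the symmetry axiom,
which makes the last two moves compatible with the braiding (`flipHom_unitSlide_counitSlide`). -/

namespace LaxVolutive

/-! ### Restricting 2-cells along a 2-functor and transporting them along a 2-transformation -/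

section Restriction
variable {C : Type u₁} [Bicategory.{w₁, v₁} C] {B : Type u} [Bicategory.{w, v} B]
  (T : C ⥤ᵖ B) {k : B}

/-- Precomposition of a 2-morphism `T p ≫ φ ⟶ T q ≫ ψ` with `T r`. -/
def restr {x y z t : C} (r : x ⟶ y) {p : y ⟶ z} {q : y ⟶ t} {φ : T.obj z ⟶ k} {ψ : T.obj t ⟶ k}
    (θ : T.map p ≫ φ ⟶ T.map q ≫ ψ) : T.map (r ≫ p) ≫ φ ⟶ T.map (r ≫ q) ≫ ψ :=
  (T.mapComp r p).hom ▷ φ ≫ (α_ _ _ _).hom ≫ T.map r ◁ θ ≫ (α_ _ _ _).inv ≫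
    (T.mapComp r q).inv ▷ ψ

lemma restr_id {x y z : C} (r : x ⟶ y) (p : y ⟶ z) (φ : T.obj z ⟶ k) :
    restr T r (𝟙 (T.map p ≫ φ)) = 𝟙 _ := by
  simp [restr, ← comp_whiskerRight]

lemma restr_comp {x y z t s : C} (r : x ⟶ y) {p : y ⟶ z} {q : y ⟶ t} {m : y ⟶ s}
    {φ : T.obj z ⟶ k} {ψ : T.obj t ⟶ k} {χ : T.obj s ⟶ k}
    (θ : T.map p ≫ φ ⟶ T.map q ≫ ψ) (θ' : T.map q ≫ ψ ⟶ T.map m ≫ χ) :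
    restr T r (θ ≫ θ') = restr T r θ ≫ restr T r θ' := by
  simp [restr, ← comp_whiskerRight_assoc]

lemma restr_whiskerRight {x y z : C} (r : x ⟶ y) {p q : y ⟶ z} (φ : T.obj z ⟶ k) (α : p ⟶ q) :
    restr T r (T.map₂ α ▷ φ) = T.map₂ (r ◁ α) ▷ φ := by
  simp [restr]

lemma whiskerRight_restr {x y z t : C} {r r' : x ⟶ y} (α : r ⟶ r') {p : y ⟶ z} {q : y ⟶ t}
    {φ : T.obj z ⟶ k} {ψ : T.obj t ⟶ k} (θ : T.map p ≫ φ ⟶ T.map q ≫ ψ) :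
    T.map₂ (α ▷ p) ▷ φ ≫ restr T r' θ = restr T r θ ≫ T.map₂ (α ▷ q) ▷ ψ := by
  simp only [restr, ← comp_whiskerRight_assoc, ← comp_whiskerRight, Category.assoc,
    Pseudofunctor.map₂_whisker_right]
  simp only [comp_whiskerRight, Category.assoc, inv_hom_whiskerRight_assoc]
  rw [associator_naturality_left_assoc, ← whisker_exchange_assoc,
    ← associator_inv_naturality_left_assoc]

/-- Associativity of the constraints `mapComp` on the two outer legs, and interchange of `mapComp r
r'` with `θ` in the middle. -/
lemma restr_restr {x x' y z t : C} (r : x ⟶ x') (r' : x' ⟶ y) {p : y ⟶ z} {q : y ⟶ t}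
    {φ : T.obj z ⟶ k} {ψ : T.obj t ⟶ k} (θ : T.map p ≫ φ ⟶ T.map q ≫ ψ) :
    restr T (r ≫ r') θ = T.map₂ (α_ r r' p).hom ▷ φ ≫ restr T r (restr T r' θ) ≫
      T.map₂ (α_ r r' q).inv ▷ ψ := by
  have h := congrArg (· ▷ ψ) (T.mapComp_assoc_left_inv r r' q)
  have h' : T.map r ◁ (T.mapComp r' q).inv ▷ ψ ≫ (α_ (T.map r) (T.map (r' ≫ q)) ψ).inv ≫
      (T.mapComp r (r' ≫ q)).inv ▷ ψ ≫ T.map₂ (α_ r r' q).inv ▷ ψ =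
      (α_ _ _ _).inv ≫ (α_ _ _ _).inv ▷ ψ ≫ (T.mapComp r r').inv ▷ T.map q ▷ ψ ≫
        (T.mapComp (r ≫ r') q).inv ▷ ψ := by
    simp only [comp_whiskerRight] at h
    simp [h]
  have e := whisker_exchange (T.mapComp r r').hom θ
  simp only [comp_whiskerLeft] at e
  simp [restr, h']
  rw [associator_naturality_left_assoc, ← reassoc_of% e]
  simp

lemma restr_one {x y z : C} {p : x ⟶ y} {q : x ⟶ z}
    {φ : T.obj y ⟶ k} {ψ : T.obj z ⟶ k} (θ : T.map p ≫ φ ⟶ T.map q ≫ ψ) :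
    restr T (𝟙 x) θ = T.map₂ (λ_ p).hom ▷ φ ≫ θ ≫ T.map₂ (λ_ q).inv ▷ ψ := by
  have e : T.map (𝟙 x) ◁ θ ≫ (T.mapId x).hom ▷ (T.map q ≫ ψ) ≫ (λ_ _).hom =
      (T.mapId x).hom ▷ (T.map p ≫ φ) ≫ (λ_ _).hom ≫ θ := by
    rw [whisker_exchange_assoc, leftUnitor_naturality]
  simp [restr]
  rw [associator_naturality_left_assoc, ← reassoc_of% e]
  simp [T.mapComp_id_left_inv q]

variable {T} {U : C ⥤ᵖ B} (β : T.StrongTrans U)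

/-- Precomposition of a 2-morphism `U p ≫ φ ⟶ U q ≫ ψ` with a strong transformation. -/
def transfer {x y z : C} {p : x ⟶ y} {q : x ⟶ z} {φ : U.obj y ⟶ k} {ψ : U.obj z ⟶ k}
    (θ : U.map p ≫ φ ⟶ U.map q ≫ ψ) :
    T.map p ≫ β.app y ≫ φ ⟶ T.map q ≫ β.app z ≫ ψ :=
  (α_ _ _ _).inv ≫ (β.naturality p).hom ▷ φ ≫ (α_ _ _ _).hom ≫ β.app x ◁ θ ≫
    (α_ _ _ _).inv ≫ (β.naturality q).inv ▷ ψ ≫ (α_ _ _ _).hom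

lemma transfer_id {x y : C} (p : x ⟶ y) (φ : U.obj y ⟶ k) :
    transfer β (𝟙 (U.map p ≫ φ)) = 𝟙 _ := by
  simp [transfer, ← comp_whiskerRight_assoc]

lemma transfer_comp {x y z t : C} {p : x ⟶ y} {q : x ⟶ z} {r : x ⟶ t} {φ : U.obj y ⟶ k}
    {ψ : U.obj z ⟶ k} {χ : U.obj t ⟶ k} (θ : U.map p ≫ φ ⟶ U.map q ≫ ψ)
    (θ' : U.map q ≫ ψ ⟶ U.map r ≫ χ) :
    transfer β (θ ≫ θ') = transfer β θ ≫ transfer β θ' := by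
  simp [transfer, ← comp_whiskerRight_assoc]

lemma transfer_whiskerRight {x y : C} {p q : x ⟶ y} (α : p ⟶ q) (φ : U.obj y ⟶ k) :
    transfer β (U.map₂ α ▷ φ) = T.map₂ α ▷ (β.app y ≫ φ) := by
  have e : (β.naturality p).hom ▷ φ ≫ (α_ _ _ _).hom ≫ β.app x ◁ U.map₂ α ▷ φ =
      T.map₂ α ▷ β.app y ▷ φ ≫ (β.naturality q).hom ▷ φ ≫ (α_ _ _ _).hom := by
    simp [← comp_whiskerRight_assoc]
  simp [transfer, reassoc_of% e]

/-- Naturality squares at composites are pastings of naturality squares; the square at the common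
first leg `r` passes `θ` by interchange and then cancels. -/
lemma transfer_restr {w x y z : C} (r : w ⟶ x) {p : x ⟶ y} {q : x ⟶ z} {φ : U.obj y ⟶ k}
    {ψ : U.obj z ⟶ k} (θ : U.map p ≫ φ ⟶ U.map q ≫ ψ) :
    transfer β (restr U r θ) = restr T r (transfer β θ) := by
  have e := whisker_exchange (β.naturality r).hom θ
  simp only [comp_whiskerLeft, Category.assoc] at e
  have e₂ : (β.naturality r).hom ▷ (U.map p ≫ φ) ≫ (α_ _ _ _).hom ≫ β.app w ◁ U.map r ◁ θ =
      (α_ _ _ _).hom ≫ T.map r ◁ β.app x ◁ θ ≫ (α_ _ _ _).inv ≫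
        (β.naturality r).hom ▷ (U.map q ≫ ψ) ≫ (α_ _ _ _).hom := by
    rw [← cancel_mono (α_ _ _ _).inv]
    simp only [Category.assoc, Iso.hom_inv_id, Category.comp_id, e]
  have e' : (α_ _ _ _).inv ≫ (β.naturality r).hom ▷ (U.map q ≫ ψ) ≫ (α_ _ _ _).hom ≫
      β.app w ◁ (α_ _ _ _).inv ≫ β.app w ◁ (U.mapComp r q).inv ▷ ψ ≫
      (α_ _ _ _).inv ≫ (β.naturality (r ≫ q)).inv ▷ ψ = T.map r ◁ (α_ _ _ _).inv ≫
      T.map r ◁ (β.naturality q).inv ▷ ψ ≫ (α_ _ _ _).inv ≫ (α_ _ _ _).inv ▷ ψ ≫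
      (T.mapComp r q).inv ▷ β.app z ▷ ψ := by
    simp [Pseudofunctor.StrongTrans.naturality_comp_inv]
  simp [transfer, restr]
  rw [associator_naturality_left_assoc, reassoc_of% e₂, reassoc_of% e']
  simp

end Restriction

/-! ### Braiding and syllepsis as operations on 2-cells -/

section Pairing
variable {B : Type u} [Bicategory.{w, v} B] {k : B}

/-- The target of the braiding is the swap followed by the tensor product. The swap is strict, so
its constraints contribute only `map₂` of an identity, and restriction along the composite is
ordinary restriction with the arguments exchanged. -/
lemma restr_swap_comp (T : B × B ⥤ᵖ B) {x y z t : B × B} (r : x ⟶ y) {p : y ⟶ z} {q : y ⟶ t}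
    {φ : T.obj (z.2, z.1) ⟶ k} {ψ : T.obj (t.2, t.1) ⟶ k}
    (θ : T.map (X := (y.2, y.1)) (Y := (z.2, z.1)) (p.2, p.1) ≫ φ ⟶
      T.map (X := (y.2, y.1)) (Y := (t.2, t.1)) (q.2, q.1) ≫ ψ) :
    restr ((Bicategory.Prod.swap B B).toPseudofunctor.comp T) r (p := p) (q := q) θ =
      restr T (x := (x.2, x.1)) (y := (y.2, y.1)) (z := (z.2, z.1)) (t := (t.2, t.1))
        (r.2, r.1) (p := (p.2, p.1)) (q := (q.2, q.1)) θ := by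
  have h {u v w : B × B} (p : u ⟶ v) (q : v ⟶ w) :
      ((Bicategory.Prod.swap B B).toPseudofunctor.comp T).mapComp p q =
        T.mapComp (a := (u.2, u.1)) (b := (v.2, v.1)) (c := (w.2, w.1)) (p.2, p.1) (q.2, q.1) := by
    ext
    exact (congrArg (· ≫ _) (T.map₂_id _)).trans (Category.id_comp _)
  simp only [restr, h]
  rfl

/-- The modification axiom whiskered with `φ`. It is applied with braiding squares for `S` and `T`
and the syllepsis for `s` and `s'`. -/
lemma whiskerLeft_comp_of_square {p q p' q' : B} {F : p ⟶ q} {G : p' ⟶ q'} {m : p ⟶ p'}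
    {m' : q ⟶ q'} {n : p' ⟶ p} {n' : q' ⟶ q} (S : F ≫ m' ≅ m ≫ G) (T : G ≫ n' ≅ n ≫ F)
    (s : m ≫ n ≅ 𝟙 p) (s' : m' ≫ n' ≅ 𝟙 q) (h : IsModificationAt (sqComp S T) (sqId F) s s')
    (φ : q ⟶ k) :
    F ◁ ((α_ _ _ _).inv ≫ s'.hom ▷ φ ≫ (λ_ φ).hom) =
      ((α_ _ _ _).inv ≫ S.hom ▷ (n' ≫ φ) ≫ (α_ _ _ _).hom ≫
        m ◁ ((α_ _ _ _).inv ≫ T.hom ▷ φ ≫ (α_ _ _ _).hom)) ≫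
          (α_ _ _ _).inv ≫ s.hom ▷ (F ≫ φ) ≫ (λ_ _).hom := by
  simp only [IsModificationAt, sqId, sqComp, Iso.trans_hom, Iso.symm_hom, whiskerRightIso_hom,
    whiskerLeftIso_hom] at h
  have h' := congrArg (fun t => (α_ F (m' ≫ n') φ).inv ≫ t ▷ φ ≫ (λ_ F).hom ▷ φ) h
  simp at h'
  simp [h']

/-- Conjugating `θ` by two layers of squares is the same as conjugating it by `s`: the modification
axiom turns the incoming squares into `s`, interchange moves `s` past `θ`, and the outgoing squares
cancel. -/
lemma conj_comp_of_squares {p q q₂ p' q' q₂' : B} {F : p ⟶ q} {F₂ : p ⟶ q₂} {G : p' ⟶ q'}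
    {G₂ : p' ⟶ q₂'} {m : p ⟶ p'} {n : p' ⟶ p} {m' : q ⟶ q'} {n' : q' ⟶ q} {m₂ : q₂ ⟶ q₂'}
    {n₂ : q₂' ⟶ q₂} (S : F ≫ m' ≅ m ≫ G) (T : G ≫ n' ≅ n ≫ F) (S₂ : F₂ ≫ m₂ ≅ m ≫ G₂)
    (T₂ : G₂ ≫ n₂ ≅ n ≫ F₂) (s : m ≫ n ≅ 𝟙 p) (s' : m' ≫ n' ≅ 𝟙 q) (s₂ : m₂ ≫ n₂ ≅ 𝟙 q₂)
    (h : IsModificationAt (sqComp S T) (sqId F) s s')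
    (h₂ : IsModificationAt (sqComp S₂ T₂) (sqId F₂) s s₂)
    {φ : q ⟶ k} {ψ : q₂ ⟶ k} (θ : F ≫ φ ⟶ F₂ ≫ ψ) :
    ((α_ _ _ _).inv ≫ S.hom ▷ (n' ≫ φ) ≫ (α_ _ _ _).hom ≫
      m ◁ ((α_ _ _ _).inv ≫ T.hom ▷ φ ≫ (α_ _ _ _).hom ≫ n ◁ θ ≫ (α_ _ _ _).inv ≫
        T₂.inv ▷ ψ ≫ (α_ _ _ _).hom) ≫ (α_ _ _ _).inv ≫ S₂.inv ▷ (n₂ ≫ ψ) ≫ (α_ _ _ _).hom) ≫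
      F₂ ◁ ((α_ _ _ _).inv ≫ s₂.hom ▷ ψ ≫ (λ_ ψ).hom) =
    F ◁ ((α_ _ _ _).inv ≫ s'.hom ▷ φ ≫ (λ_ φ).hom) ≫ θ := by
  have e : (α_ _ _ _).inv ≫ s.hom ▷ (F ≫ φ) ≫ (λ_ _).hom ≫ θ =
      m ◁ n ◁ θ ≫ (α_ _ _ _).inv ≫ s.hom ▷ (F₂ ≫ ψ) ≫ (λ_ _).hom := by
    rw [← leftUnitor_naturality, ← whisker_exchange_assoc]
    simp
  rw [whiskerLeft_comp_of_square _ _ _ _ h, whiskerLeft_comp_of_square _ _ _ _ h₂]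
  simp only [Category.assoc, e]
  simp only [whiskerLeft_comp, Category.assoc, Iso.hom_inv_id_assoc, Iso.inv_hom_id_assoc,
    inv_hom_whiskerRight_assoc, whiskerLeft_hom_inv_assoc, whiskerLeft_inv_hom_whiskerRight_assoc,
    whiskerLeft_inv_hom_assoc]

lemma whiskerLeft_comp_of_symmetry {p q : B} {f : p ⟶ q} {g : q ⟶ p} (s : f ≫ g ≅ 𝟙 p)
    (t : g ≫ f ≅ 𝟙 q) (h : f ◁ᵢ t ≪≫ ρ_ f = (α_ f g f).symm ≪≫ s ▷ᵢ f ≪≫ λ_ f) (φ : q ⟶ k) :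
    f ◁ ((α_ _ _ _).inv ≫ t.hom ▷ φ ≫ (λ_ φ).hom) =
      (α_ _ _ _).inv ≫ s.hom ▷ (f ≫ φ) ≫ (λ_ _).hom := by
  have h := congrArg (fun t => (α_ _ _ _).inv ≫ t.hom ▷ φ) h
  simp at h
  simp [h]

/-! ### Calculus of pairings pulled back along tensor products -/

section Tensor
variable [TensorBicategory B]

/-- The restriction of a pairing `φ : y ⊠ b ⟶ k` along `f` and `g`. -/
def pull {x y a b : B} (f : x ⟶ y) (g : a ⟶ b) (φ : y ⊠ b ⟶ k) : x ⊠ a ⟶ k := (f ⊠₁ g) ≫ φ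

/-- The action of 2-morphisms on restrictions of pairings. -/
def act {x y a b : B} {f f' : x ⟶ y} {g g' : a ⟶ b} (α : f ⟶ f') (β : g ⟶ g')
    (φ : y ⊠ b ⟶ k) : pull f g φ ⟶ pull f' g' φ :=
  tHom₂ α β ▷ φ

/-- Restriction of 2-morphisms between restrictions of pairings. -/
def res {x y z w a b c d : B} (r : w ⟶ x) (s : d ⟶ a) {f : x ⟶ y} {g : a ⟶ b} {f' : x ⟶ z}
    {g' : a ⟶ c} {φ : y ⊠ b ⟶ k} {ψ : z ⊠ c ⟶ k} (θ : pull f g φ ⟶ pull f' g' ψ) :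
    pull (r ≫ f) (s ≫ g) φ ⟶ pull (r ≫ f') (s ≫ g') ψ :=
  restr TensorBicategory.tensor (x := (w, d)) (y := (x, a)) (z := (y, b)) (t := (z, c)) (r, s)
    (p := (f, g)) (q := (f', g')) θ

section
variable {x y z w a b c d : B}

@[simp]
lemma act_id (f : x ⟶ y) (g : a ⟶ b) (φ : y ⊠ b ⟶ k) : act (𝟙 f) (𝟙 g) φ = 𝟙 _ := by
  have h : tHom₂ (𝟙 f) (𝟙 g) = 𝟙 _ :=
    TensorBicategory.tensor.map₂_id (a := (x, a)) (b := (y, b)) (f, g)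
  simp [act, h, pull]

lemma act_comp {f f' f'' : x ⟶ y} {g g' g'' : a ⟶ b} (α : f ⟶ f') (β : g ⟶ g') (α' : f' ⟶ f'')
    (β' : g' ⟶ g'') (φ : y ⊠ b ⟶ k) : act α β φ ≫ act α' β' φ = act (α ≫ α') (β ≫ β') φ := by
  have h : tHom₂ (α ≫ α') (β ≫ β') = tHom₂ α β ≫ tHom₂ α' β' :=
    TensorBicategory.tensor.map₂_comp (a := (x, a)) (b := (y, b)) (f := (f, g)) (g := (f', g'))
      (h := (f'', g'')) (α, β) (α', β')
  exact ((congrArg (· ▷ φ) h).trans (comp_whiskerRight _ _ _)).symm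

lemma act_comp_assoc {f f' f'' : x ⟶ y} {g g' g'' : a ⟶ b} (α : f ⟶ f') (β : g ⟶ g')
    (α' : f' ⟶ f'') (β' : g' ⟶ g'') (φ : y ⊠ b ⟶ k) {m : x ⊠ a ⟶ k} (θ : pull f'' g'' φ ⟶ m) :
    act α β φ ≫ act α' β' φ ≫ θ = act (α ≫ α') (β ≫ β') φ ≫ θ := by
  rw [← Category.assoc, act_comp]

lemma act_whiskerLeft_comp (r : w ⟶ x) {f f' f'' : x ⟶ y} (g : a ⟶ b) (α : f ⟶ f')
    (α' : f' ⟶ f'') (φ : y ⊠ b ⟶ k) :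
    act (r ◁ (α ≫ α')) (𝟙 g) φ = act (r ◁ α) (𝟙 g) φ ≫ act (r ◁ α') (𝟙 g) φ := by
  simp [act_comp]

lemma act_whisker_assoc (r : z ⟶ w) {f f' : w ⟶ x} (h : x ⟶ y) (g : a ⟶ b) (α : f ⟶ f')
    (φ : y ⊠ b ⟶ k) :
    act (r ◁ (α ▷ h)) (𝟙 g) φ ≫ act (α_ r f' h).inv (𝟙 g) φ =
      act (α_ r f h).inv (𝟙 g) φ ≫ act ((r ◁ α) ▷ h) (𝟙 g) φ := by
  simp [act_comp]

lemma act_whiskerLeft_assoc (r : z ⟶ w) (h : w ⟶ x) {f f' : x ⟶ y} (g : a ⟶ b) (α : f ⟶ f')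
    (φ : y ⊠ b ⟶ k) :
    act (r ◁ (h ◁ α)) (𝟙 g) φ ≫ act (α_ r h f').inv (𝟙 g) φ =
      act (α_ r h f).inv (𝟙 g) φ ≫ act ((r ≫ h) ◁ α) (𝟙 g) φ := by
  simp [act_comp]

lemma act_eq_left {f f' : x ⟶ y} {g g' : a ⟶ b} (α : f ⟶ f') (β : g ⟶ g') (φ : y ⊠ b ⟶ k) :
    act α β φ = act α (𝟙 g) φ ≫ act (𝟙 f') β φ := by
  simp [act_comp]

@[simp]
lemma res_id (r : w ⟶ x) (s : d ⟶ a) (f : x ⟶ y) (g : a ⟶ b) (φ : y ⊠ b ⟶ k) :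
    res r s (𝟙 (pull f g φ)) = 𝟙 _ :=
  restr_id TensorBicategory.tensor (x := (w, d)) (y := (x, a)) (z := (y, b)) (r, s) (f, g) φ

lemma res_comp {t e : B} (r : w ⟶ x) (s : d ⟶ a) {f : x ⟶ y} {g : a ⟶ b} {f' : x ⟶ z}
    {g' : a ⟶ c} {f'' : x ⟶ t} {g'' : a ⟶ e} {φ : y ⊠ b ⟶ k} {ψ : z ⊠ c ⟶ k} {χ : t ⊠ e ⟶ k}
    (θ : pull f g φ ⟶ pull f' g' ψ) (θ' : pull f' g' ψ ⟶ pull f'' g'' χ) :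
    res r s (θ ≫ θ') = res r s θ ≫ res r s θ' :=
  restr_comp TensorBicategory.tensor (x := (w, d)) (y := (x, a)) (z := (y, b)) (t := (z, c))
    (s := (t, e)) (r, s) (p := (f, g)) (q := (f', g')) (m := (f'', g'')) θ θ'

lemma res_act (r : w ⟶ x) (s : d ⟶ a) {f f' : x ⟶ y} {g g' : a ⟶ b} (α : f ⟶ f') (β : g ⟶ g')
    (φ : y ⊠ b ⟶ k) : res r s (act α β φ) = act (r ◁ α) (s ◁ β) φ :=
  restr_whiskerRight TensorBicategory.tensor (x := (w, d)) (y := (x, a)) (z := (y, b)) (r, s)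
    (p := (f, g)) (q := (f', g')) φ (α, β)

lemma act_res {r r' : w ⟶ x} {s s' : d ⟶ a} (α : r ⟶ r') (β : s ⟶ s') {f : x ⟶ y} {g : a ⟶ b}
    {f' : x ⟶ z} {g' : a ⟶ c} {φ : y ⊠ b ⟶ k} {ψ : z ⊠ c ⟶ k}
    (θ : pull f g φ ⟶ pull f' g' ψ) :
    act (α ▷ f) (β ▷ g) φ ≫ res r' s' θ = res r s θ ≫ act (α ▷ f') (β ▷ g') ψ :=
  whiskerRight_restr TensorBicategory.tensor (x := (w, d)) (y := (x, a)) (z := (y, b))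
    (t := (z, c)) (r := (r, s)) (r' := (r', s')) (α, β) (p := (f, g)) (q := (f', g')) θ

lemma res_res {w' d' : B} (r : w' ⟶ w) (s : d' ⟶ d) (r' : w ⟶ x) (s' : d ⟶ a) {f : x ⟶ y}
    {g : a ⟶ b} {f' : x ⟶ z} {g' : a ⟶ c} {φ : y ⊠ b ⟶ k} {ψ : z ⊠ c ⟶ k}
    (θ : pull f g φ ⟶ pull f' g' ψ) :
    res (r ≫ r') (s ≫ s') θ = act (α_ r r' f).hom (α_ s s' g).hom φ ≫
      res r s (res r' s' θ) ≫ act (α_ r r' f').inv (α_ s s' g').inv ψ :=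
  restr_restr TensorBicategory.tensor (x := (w', d')) (x' := (w, d)) (y := (x, a)) (z := (y, b))
    (t := (z, c)) (r, s) (r', s') (p := (f, g)) (q := (f', g')) θ

lemma res_res' {w' d' : B} (r : w' ⟶ w) (s : d' ⟶ d) (r' : w ⟶ x) (s' : d ⟶ a) {f : x ⟶ y}
    {g : a ⟶ b} {f' : x ⟶ z} {g' : a ⟶ c} {φ : y ⊠ b ⟶ k} {ψ : z ⊠ c ⟶ k}
    (θ : pull f g φ ⟶ pull f' g' ψ) :
    res r s (res r' s' θ) = act (α_ r r' f).inv (α_ s s' g).inv φ ≫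
      res (r ≫ r') (s ≫ s') θ ≫ act (α_ r r' f').hom (α_ s s' g').hom ψ := by
  simp [res_res, act_comp_assoc, act_comp]

/-- Replaces the restricting 1-morphisms by isomorphic ones; its use is to strip unitors from
arguments such as `g ≫ 𝟙 a`. -/
lemma res_congr {r r' : w ⟶ x} {s s' : d ⟶ a} (α : r ≅ r') (β : s ≅ s') {f : x ⟶ y} {g : a ⟶ b}
    {f' : x ⟶ z} {g' : a ⟶ c} {φ : y ⊠ b ⟶ k} {ψ : z ⊠ c ⟶ k}
    (θ : pull f g φ ⟶ pull f' g' ψ) :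
    res r s θ = act (α.hom ▷ f) (β.hom ▷ g) φ ≫ res r' s' θ ≫
      act (α.inv ▷ f') (β.inv ▷ g') ψ := by
  rw [← act_res, act_comp_assoc]
  simp

lemma res_one {f : x ⟶ y} {g : a ⟶ b} {f' : x ⟶ z} {g' : a ⟶ c} {φ : y ⊠ b ⟶ k}
    {ψ : z ⊠ c ⟶ k} (θ : pull f g φ ⟶ pull f' g' ψ) :
    res (𝟙 x) (𝟙 a) θ =
      act (λ_ f).hom (λ_ g).hom φ ≫ θ ≫ act (λ_ f').inv (λ_ g').inv ψ :=
  restr_one TensorBicategory.tensor (x := (x, a)) (y := (y, b))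
    (z := (z, c)) (p := (f, g)) (q := (f', g')) θ

/-- The action of 2-isomorphisms on restrictions of pairings. -/
@[simps]
def actIso {f f' : x ⟶ y} {g g' : a ⟶ b} (α : f ≅ f') (β : g ≅ g') (φ : y ⊠ b ⟶ k) :
    pull f g φ ≅ pull f' g' φ where
  hom := act α.hom β.hom φ
  inv := act α.inv β.inv φ
  hom_inv_id := by simp [act_comp]
  inv_hom_id := by simp [act_comp]

instance {f f' : x ⟶ y} {g g' : a ⟶ b} (α : f ⟶ f') (β : g ⟶ g') (φ : y ⊠ b ⟶ k) [IsIso α]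
    [IsIso β] : IsIso (act α β φ) :=
  (actIso (asIso α) (asIso β) φ).isIso_hom

/-- Restriction of 2-isomorphisms between restrictions of pairings. -/
@[simps]
def resIso (r : w ⟶ x) (s : d ⟶ a) {f : x ⟶ y} {g : a ⟶ b} {f' : x ⟶ z}
    {g' : a ⟶ c} {φ : y ⊠ b ⟶ k} {ψ : z ⊠ c ⟶ k} (θ : pull f g φ ≅ pull f' g' ψ) :
    pull (r ≫ f) (s ≫ g) φ ≅ pull (r ≫ f') (s ≫ g') ψ where
  hom := res r s θ.hom
  inv := res r s θ.inv
  hom_inv_id := by simp [← res_comp]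
  inv_hom_id := by simp [← res_comp]

end

end Tensor

/-! ### Exchanging the two arguments of a pairing -/

section Braiding
variable [BraidingData B] {x y z w a b c d : B}

/-- Precomposition of a pairing with the braiding. -/
def flip (φ : y ⊠ b ⟶ k) : b ⊠ y ⟶ k := br b y ≫ φ

/-- The action of the braiding on 2-morphisms between restrictions of pairings. -/
def flipHom {f : x ⟶ y} {g : a ⟶ b} {f' : x ⟶ z} {g' : a ⟶ c} {φ : y ⊠ b ⟶ k} {ψ : z ⊠ c ⟶ k}
    (θ : pull f g φ ⟶ pull f' g' ψ) : pull g f (flip φ) ⟶ pull g' f' (flip ψ) :=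
  transfer BraidingData.braiding (x := (a, x)) (y := (b, y)) (z := (c, z)) (p := (g, f))
    (q := (g', f')) θ

@[simp]
lemma flipHom_id (f : x ⟶ y) (g : a ⟶ b) (φ : y ⊠ b ⟶ k) : flipHom (𝟙 (pull f g φ)) = 𝟙 _ :=
  transfer_id BraidingData.braiding (x := (a, x)) (y := (b, y)) (g, f) φ

lemma flipHom_comp {t e : B} {f : x ⟶ y} {g : a ⟶ b} {f' : x ⟶ z}
    {g' : a ⟶ c} {f'' : x ⟶ t} {g'' : a ⟶ e} {φ : y ⊠ b ⟶ k} {ψ : z ⊠ c ⟶ k} {χ : t ⊠ e ⟶ k}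
    (θ : pull f g φ ⟶ pull f' g' ψ) (θ' : pull f' g' ψ ⟶ pull f'' g'' χ) :
    flipHom (θ ≫ θ') = flipHom θ ≫ flipHom θ' :=
  transfer_comp BraidingData.braiding (x := (a, x)) (y := (b, y)) (z := (c, z)) (t := (e, t))
    (p := (g, f)) (q := (g', f')) (r := (g'', f'')) θ θ'

lemma flipHom_act {f f' : x ⟶ y} {g g' : a ⟶ b} (α : f ⟶ f') (β : g ⟶ g') (φ : y ⊠ b ⟶ k) :
    flipHom (act α β φ) = act β α (flip φ) :=
  transfer_whiskerRight BraidingData.braiding (x := (a, x)) (y := (b, y)) (p := (g, f))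
    (q := (g', f')) (β, α) φ

lemma flipHom_res (r : w ⟶ x) (s : d ⟶ a) {f : x ⟶ y} {g : a ⟶ b} {f' : x ⟶ z}
    {g' : a ⟶ c} {φ : y ⊠ b ⟶ k} {ψ : z ⊠ c ⟶ k} (θ : pull f g φ ⟶ pull f' g' ψ) :
    flipHom (res r s θ) = res s r (flipHom θ) := by
  refine Eq.trans ?_ (transfer_restr BraidingData.braiding (w := (d, w)) (x := (a, x)) (y := (b, y))
    (z := (c, z)) (s, r) (p := (g, f)) (q := (g', f')) θ)
  exact congrArg (transfer BraidingData.braiding (x := (d, w)) (y := (b, y)) (z := (c, z))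
    (p := (s ≫ g, r ≫ f)) (q := (s ≫ g', r ≫ f')))
    (restr_swap_comp TensorBicategory.tensor (x := (d, w)) (y := (a, x)) (z := (b, y))
      (t := (c, z)) (s, r) (p := (g, f)) (q := (g', f')) θ).symm

/-- The action of the braiding on 2-isomorphisms between restrictions of pairings. -/
@[simps]
def flipIso {f : x ⟶ y} {g : a ⟶ b} {f' : x ⟶ z} {g' : a ⟶ c} {φ : y ⊠ b ⟶ k} {ψ : z ⊠ c ⟶ k}
    (θ : pull f g φ ≅ pull f' g' ψ) : pull g f (flip φ) ≅ pull g' f' (flip ψ) where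
  hom := flipHom θ.hom
  inv := flipHom θ.inv
  hom_inv_id := by simp [← flipHom_comp]
  inv_hom_id := by simp [← flipHom_comp]

end Braiding

/-! ### Double braiding of pairings -/

section Symmetric
variable [SymmetricMonoidalBicategory B] {x y z w a b c d : B}
open SyllepticMonoidalBicategory SymmetricMonoidalBicategory

/-- The syllepsis as a 2-isomorphism of pairings. -/
def syl (f : x ⟶ y) (g : a ⟶ b) (φ : y ⊠ b ⟶ k) : pull f g (flip (flip φ)) ≅ pull f g φ :=
  whiskerLeftIso (f ⊠₁ g)
    ((α_ _ _ _).symm ≪≫ whiskerRightIso (syllepsis y b) φ ≪≫ λ_ φ)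

/-- The 2-cell `syl` is a fixed 2-cell of pairings whiskered by `f ⊠₁ g`, so restricting only
enlarges the whiskering 1-morphism; the constraint `tComp` cancels by interchange. -/
lemma res_syl (r : w ⟶ x) (s : d ⟶ a) (f : x ⟶ y) (g : a ⟶ b) (φ : y ⊠ b ⟶ k) :
    res r s (syl f g φ).hom = (syl (r ≫ f) (s ≫ g) φ).hom := by
  have h {u v : B} (m : u ⟶ v) {p q : v ⟶ k} (t : p ⟶ q) {n : u ⟶ v} (i : n ≅ m) :
      i.hom ▷ p ≫ m ◁ t ≫ i.inv ▷ q = n ◁ t := by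
    rw [← whisker_exchange_assoc]
    simp
  have h {u u' v : B} (m : u ⟶ u') (m' : u' ⟶ v) {p q : v ⟶ k} (t : p ⟶ q) {n : u ⟶ v}
      (i : n ≅ m ≫ m') :
      i.hom ▷ p ≫ (α_ _ _ _).hom ≫ m ◁ m' ◁ t ≫ (α_ _ _ _).inv ≫ i.inv ▷ q = n ◁ t := by
    rw [← h (m ≫ m') t i]
    simp
  exact h _ _ _ (tComp r f s g)

/-- This is where the syllepsis being a modification enters: up to `syl`, flipping twice is the
identity operation on 2-cells. -/
lemma flipHom_flipHom_syl {f : x ⟶ y} {g : a ⟶ b} {f' : x ⟶ z} {g' : a ⟶ c} {φ : y ⊠ b ⟶ k}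
    {ψ : z ⊠ c ⟶ k} (θ : pull f g φ ⟶ pull f' g' ψ) :
    flipHom (flipHom θ) ≫ (syl f' g' ψ).hom = (syl f g φ).hom ≫ θ :=
  conj_comp_of_squares (brSq f g) (brSq g f) (brSq f' g') (brSq g' f') _ _ _
    (syllepsis_natural f g) (syllepsis_natural f' g') θ

/-- The naturality squares of the braiding cancel against each other, leaving the syllepsis
whiskered by a braiding on the left; the symmetry axiom says that this equals the other whiskering.
-/
lemma flipHom_syl (f : x ⟶ y) (g : a ⟶ b) (φ : y ⊠ b ⟶ k) :
    flipHom (syl f g φ).hom = (syl g f (flip φ)).hom := by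
  have h {X Y X' Y' : B} {p : X ⟶ Y} {q : X' ⟶ Y'} {n : X ⟶ X'} {n' : Y ⟶ Y'}
      (S : p ≫ n' ≅ n ≫ q) {φ ψ : Y' ⟶ k} (t : φ ⟶ ψ) :
      (α_ _ _ _).inv ≫ S.hom ▷ φ ≫ (α_ _ _ _).hom ≫ n ◁ q ◁ t ≫ (α_ _ _ _).inv ≫
        S.inv ▷ ψ ≫ (α_ _ _ _).hom = p ◁ n' ◁ t := by
    rw [associator_inv_naturality_right_assoc, whisker_exchange_assoc]
    simp
  refine (h (brSq g f) _).trans (congrArg (fun t => (g ⊠₁ f) ◁ t) ?_)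
  exact whiskerLeft_comp_of_symmetry _ _ (symmetry b y) φ

end Symmetric
end Pairing
-- The 2-functor `1 ^ (-)`
section Dual
variable {B : Type u} [Bicategory.{w, v} B]

/-- Rebrackets the pasting diagram of `DualityFunctor.mapIso_comp` so that its two parenthesised
blocks are literally restrictions `res`. -/
lemma pasting_hom {x y₁ y₂ y₃ y₄ y₅ k : B} {p₁ p₂ p₃ : x ⟶ y₁} {q₁ : x ⟶ y₂} {q₂ : y₂ ⟶ y₁}
    {q₃ : y₂ ⟶ y₃} {p₄ p₅ : x ⟶ y₃} {q₄ : x ⟶ y₄} {q₅ : y₄ ⟶ y₃} {q₆ : y₄ ⟶ y₅}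
    {p₆ p₇ : x ⟶ y₅} {e₁ : y₁ ⟶ k} {e₂ : y₃ ⟶ k} {e₃ : y₅ ⟶ k} (i₁ : p₁ ≅ p₂) (i₂ : p₂ ≅ p₃)
    (t₁ : p₃ ≅ q₁ ≫ q₂) (m : q₂ ≫ e₁ ≅ q₃ ≫ e₂) (t₂ : p₄ ≅ q₁ ≫ q₃) (i₃ : p₄ ≅ p₅)
    (t₃ : p₅ ≅ q₄ ≫ q₅) (n : q₅ ≫ e₂ ≅ q₆ ≫ e₃) (i₄ : p₆ ≅ p₇)
    (t₄ : p₇ ≅ q₄ ≫ q₆) :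
    ((i₁ ≪≫ i₂ ≪≫ t₁) ▷ᵢ e₁ ≪≫ α_ _ _ _ ≪≫ q₁ ◁ᵢ m ≪≫ (α_ _ _ _).symm ≪≫
      (t₂.symm ≪≫ i₃ ≪≫ t₃) ▷ᵢ e₂ ≪≫ α_ _ _ _ ≪≫ q₄ ◁ᵢ n ≪≫ (α_ _ _ _).symm ≪≫
        (i₄ ≪≫ t₄).symm ▷ᵢ e₃).hom =
      i₁.hom ▷ e₁ ≫ i₂.hom ▷ e₁ ≫ (t₁.hom ▷ e₁ ≫ (α_ _ _ _).hom ≫ q₁ ◁ m.hom ≫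
        (α_ _ _ _).inv ≫ t₂.inv ▷ e₂) ≫ i₃.hom ▷ e₂ ≫ (t₃.hom ▷ e₂ ≫ (α_ _ _ _).hom ≫
          q₄ ◁ n.hom ≫ (α_ _ _ _).inv ≫ t₄.inv ▷ e₃) ≫ i₄.inv ▷ e₃ := by
  simp

variable [SymmetricMonoidalBicategory B] [ZeroClosed B]

/-- The dual `1 ^ a`. -/
def dualObj (a : B) : B := ihom a (tUnit B)

/-- The evaluation `1 ^ a ⊠ a ⟶ 1`. -/
def dualEv (a : B) : dualObj a ⊠ a ⟶ tUnit B := ihomEv a (tUnit B)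

variable {a b c x y z w : B}

/-- 0-closedness with target the unit object. Essential surjectivity produces 1-morphisms into
duals, fullness produces 2-cells, and faithfulness proves equations. -/
instance (a x : B) : (transposeFunctor (tensorRight a) (dualEv a) x).IsEquivalence :=
  (ZeroClosed.rightAdjoint a).isEquivalence (tUnit B) x

lemma act_injective {f g : x ⟶ dualObj a} {α β : f ⟶ g}
    (h : act α (𝟙 (𝟙 a)) (dualEv a) = act β (𝟙 (𝟙 a)) (dualEv a)) : α = β :=
  (transposeFunctor (tensorRight a) (dualEv a) x).map_injective h

lemma act_whiskerLeft_injective {f g : x ⟶ dualObj a} {α β : f ⟶ g}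
    (h : act (𝟙 x ◁ α) (𝟙 (𝟙 a)) (dualEv a) = act (𝟙 x ◁ β) (𝟙 (𝟙 a)) (dualEv a)) : α = β := by
  simpa using act_injective h

/-- The 1-morphism corresponding to a pairing. -/
noncomputable def lift (φ : x ⊠ a ⟶ tUnit B) : x ⟶ dualObj a :=
  (transposeFunctor (tensorRight a) (dualEv a) x).objPreimage φ

noncomputable def liftIso (φ : x ⊠ a ⟶ tUnit B) : pull (lift φ) (𝟙 a) (dualEv a) ≅ φ :=
  (transposeFunctor (tensorRight a) (dualEv a) x).objObjPreimageIso φ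

/-- The 2-isomorphism corresponding to a 2-isomorphism of pairings. -/
noncomputable def transposeIso {f g : x ⟶ dualObj a}
    (θ : pull f (𝟙 a) (dualEv a) ≅ pull g (𝟙 a) (dualEv a)) : f ≅ g :=
  (transposeFunctor (tensorRight a) (dualEv a) x).preimageIso θ

lemma act_transposeIso {f g : x ⟶ dualObj a}
    (θ : pull f (𝟙 a) (dualEv a) ≅ pull g (𝟙 a) (dualEv a)) :
    act (transposeIso θ).hom (𝟙 (𝟙 a)) (dualEv a) = θ.hom :=
  (transposeFunctor (tensorRight a) (dualEv a) x).map_preimage θ.hom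

/-- The 2-morphism corresponding to a 2-morphism of pairings. -/
noncomputable def transposeHom {f g : x ⟶ dualObj a}
    (θ : pull f (𝟙 a) (dualEv a) ⟶ pull g (𝟙 a) (dualEv a)) : f ⟶ g :=
  (transposeFunctor (tensorRight a) (dualEv a) x).preimage θ

lemma act_transposeHom {f g : x ⟶ dualObj a}
    (θ : pull f (𝟙 a) (dualEv a) ⟶ pull g (𝟙 a) (dualEv a)) :
    act (transposeHom θ) (𝟙 (𝟙 a)) (dualEv a) = θ :=
  (transposeFunctor (tensorRight a) (dualEv a) x).map_preimage θ

/-- The 1-morphism `1 ^ X`. -/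
noncomputable def dualHom (X : a ⟶ b) : dualObj b ⟶ dualObj a :=
  lift (pull (𝟙 (dualObj b)) X (dualEv b))

noncomputable def dualHomIso (X : a ⟶ b) :
    pull (dualHom X) (𝟙 a) (dualEv a) ≅ pull (𝟙 (dualObj b)) X (dualEv b) :=
  liftIso _

/-- Moving a 1-morphism from one side of the evaluation to the other. -/
noncomputable def slide (f : x ⟶ dualObj b) (X : a ⟶ b) (g : y ⟶ a) :
    pull (f ≫ dualHom X) g (dualEv a) ≅ pull f (g ≫ X) (dualEv b) :=
  actIso (Iso.refl _) (ρ_ g).symm (dualEv a) ≪≫ resIso f g (dualHomIso X) ≪≫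
    actIso (ρ_ f) (Iso.refl _) (dualEv b)

/-- A slide is a restriction of `dualHomIso X` along its arguments, so 2-cells on the arguments pass
through it by interchange (`act_res`). -/
lemma slide_natural {f f' : x ⟶ dualObj b} (X : a ⟶ b) {g g' : y ⟶ a} (α : f ⟶ f')
    (β : g ⟶ g') : act (α ▷ dualHom X) β (dualEv a) ≫ (slide f' X g').hom =
      (slide f X g).hom ≫ act α (β ▷ X) (dualEv b) := by
  have h := act_res α β (dualHomIso X).hom
  have h₁ : act (α ▷ dualHom X) β (dualEv a) ≫ act (𝟙 _) (ρ_ g').inv _ =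
    act (𝟙 _) (ρ_ g).inv _ ≫ act (α ▷ dualHom X) (β ▷ 𝟙 a) (dualEv a) := by
    simp [act_comp]
  simp only [slide, Iso.trans_hom, actIso_hom, resIso_hom, Iso.refl_hom, Iso.symm_hom,
    Category.assoc]
  rw [reassoc_of% h₁, reassoc_of% h, act_comp, act_comp]
  simp

lemma slide_natural_left {f f' : x ⟶ dualObj b} (X : a ⟶ b) (g : y ⟶ a) (α : f ⟶ f') :
    act (α ▷ dualHom X) (𝟙 g) (dualEv a) ≫ (slide f' X g).hom =
      (slide f X g).hom ≫ act α (𝟙 _) (dualEv b) := by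
  simpa using slide_natural X α (𝟙 g)

lemma slide_natural_right (f : x ⟶ dualObj b) (X : a ⟶ b) {g g' : y ⟶ a} (β : g ⟶ g') :
    act (𝟙 _) β (dualEv a) ≫ (slide f X g').hom =
      (slide f X g).hom ≫ act (𝟙 f) (β ▷ X) (dualEv b) := by
  simpa using slide_natural X (𝟙 f) β

lemma slide_congr {f f' : x ⟶ dualObj b} (X : a ⟶ b) {g g' : y ⟶ a} (α : f ≅ f')
    (β : g ≅ g') : (slide f X g).hom =
      act (α.hom ▷ dualHom X) β.hom (dualEv a) ≫ (slide f' X g').hom ≫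
        act α.inv (β.inv ▷ X) (dualEv b) := by
  rw [reassoc_of% slide_natural, act_comp]
  simp

lemma res_slide (r : w ⟶ x) (s : z ⟶ y) (f : x ⟶ dualObj b) (X : a ⟶ b) (g : y ⟶ a) :
    res r s (slide f X g).hom = act (α_ r f (dualHom X)).inv (𝟙 _) (dualEv a) ≫
      (slide (r ≫ f) X (s ≫ g)).hom ≫ act (𝟙 _) (α_ s g X).hom (dualEv b) := by
  simp only [slide, Iso.trans_hom, actIso_hom, resIso_hom, Iso.refl_hom, Iso.symm_hom,
    Category.assoc, res_comp, res_act, res_res, act_comp_assoc, act_comp]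
  simp

/-- The 2-morphism `1 ^ η`. -/
noncomputable def dualHom₂ {X Y : a ⟶ b} (η : X ⟶ Y) : dualHom X ⟶ dualHom Y :=
  transposeHom ((dualHomIso X).hom ≫ act (𝟙 _) η _ ≫ (dualHomIso Y).inv)

lemma act_dualHom₂ {X Y : a ⟶ b} (η : X ⟶ Y) :
    act (dualHom₂ η) (𝟙 (𝟙 a)) (dualEv a) ≫ (dualHomIso Y).hom =
      (dualHomIso X).hom ≫ act (𝟙 _) η _ := by
  simp [dualHom₂, act_transposeHom]

/-- The defining equation of `dualHom₂ η`, restricted from identity arguments to arbitrary ones. -/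
lemma act_dualHom₂_slide (f : x ⟶ dualObj b) {X Y : a ⟶ b} (η : X ⟶ Y) (g : y ⟶ a) :
    act (f ◁ dualHom₂ η) (𝟙 g) (dualEv a) ≫ (slide f Y g).hom =
      (slide f X g).hom ≫ act (𝟙 f) (g ◁ η) (dualEv b) := by
  have h := congrArg (res f g) (act_dualHom₂ η)
  simp only [res_comp, res_act] at h
  have h₁ : act (f ◁ dualHom₂ η) (𝟙 g) (dualEv a) ≫ act (𝟙 _) (ρ_ g).inv _ =
    act (𝟙 _) (ρ_ g).inv _ ≫ act (f ◁ dualHom₂ η) (g ◁ 𝟙 _) (dualEv a) := by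
    simp [act_comp]
  simp only [slide, Iso.trans_hom, actIso_hom, resIso_hom, Iso.refl_hom, Iso.symm_hom,
    Category.assoc]
  rw [reassoc_of% h₁, reassoc_of% h, act_comp, act_comp]
  simp

/-- The unit constraint of `1 ^ (-)`. -/
noncomputable def dualId (a : B) : dualHom (𝟙 a) ≅ 𝟙 (dualObj a) :=
  transposeIso (dualHomIso (𝟙 a))

lemma slide_id (f : x ⟶ dualObj a) (g : y ⟶ a) : (slide f (𝟙 a) g).hom =
    act (f ◁ (dualId a).hom ≫ (ρ_ f).hom) (ρ_ g).inv (dualEv a) := by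
  have h := act_transposeIso (dualHomIso (𝟙 a))
  simp only [slide, Iso.trans_hom, actIso_hom, resIso_hom, Iso.refl_hom, Iso.symm_hom,
    ← h, res_act, act_comp]
  simp [dualId]

/-- The composite of two evaluations corresponding to a composite of 1-morphisms. -/
noncomputable def dualHomIsoComp (X : a ⟶ b) (Y : b ⟶ c) :
    pull (dualHom Y ≫ dualHom X) (𝟙 a) (dualEv a) ≅ pull (𝟙 _) (X ≫ Y) (dualEv c) :=
  actIso (Iso.refl _) (λ_ (𝟙 a)).symm _ ≪≫ resIso (dualHom Y) (𝟙 a) (dualHomIso X) ≪≫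
    actIso (ρ_ _ ≪≫ (λ_ _).symm) (λ_ X ≪≫ (ρ_ X).symm) _ ≪≫
    resIso (𝟙 _) X (dualHomIso Y) ≪≫ actIso (λ_ _) (Iso.refl _) _

/-- The composition constraint of `1 ^ (-)`. -/
noncomputable def dualComp (X : a ⟶ b) (Y : b ⟶ c) :
    dualHom (X ≫ Y) ≅ dualHom Y ≫ dualHom X :=
  transposeIso (dualHomIso (X ≫ Y) ≪≫ (dualHomIsoComp X Y).symm)

lemma dualHomIso_comp (X : a ⟶ b) (Y : b ⟶ c) : (dualHomIso (X ≫ Y)).hom =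
    act (dualComp X Y).hom (λ_ (𝟙 a)).inv _ ≫ res (dualHom Y) (𝟙 a) (dualHomIso X).hom ≫
      act ((ρ_ _).hom ≫ (λ_ _).inv) ((λ_ X).hom ≫ (ρ_ X).inv) _ ≫
      res (𝟙 _) X (dualHomIso Y).hom ≫ act (λ_ _).hom (𝟙 _) _ := by
  have h := act_transposeIso (dualHomIso (X ≫ Y) ≪≫ (dualHomIsoComp X Y).symm)
  have h' : (dualHomIso (X ≫ Y)).hom = act (dualComp X Y).hom (𝟙 _) (dualEv a) ≫
      (dualHomIsoComp X Y).hom := by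
    rw [dualComp, h]
    simp
  rw [h']
  simp only [dualHomIsoComp, Iso.trans_hom, actIso_hom, resIso_hom, Iso.refl_hom, Iso.symm_hom,
    act_comp_assoc, Category.comp_id, Category.id_comp]

/-- Sliding along a composite is sliding along its factors one after the other: `dualComp` was
defined to make this true at identity arguments, and restriction gives the general case up to
coherence. -/
lemma act_dualComp_slide (f : x ⟶ dualObj c) (X : a ⟶ b) (Y : b ⟶ c) (g : y ⟶ a) :
    act (f ◁ (dualComp X Y).hom) (𝟙 g) (dualEv a) ≫
      act (α_ f (dualHom Y) (dualHom X)).inv (𝟙 g) (dualEv a) ≫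
      (slide (f ≫ dualHom Y) X g).hom ≫ (slide f Y (g ≫ X)).hom =
    (slide f (X ≫ Y) g).hom ≫ act (𝟙 f) (α_ g X Y).inv (dualEv c) := by
  simp only [slide, Iso.trans_hom, actIso_hom, resIso_hom, Iso.refl_hom, Iso.symm_hom,
    Category.assoc, dualHomIso_comp, res_comp, res_act, res_res', act_comp_assoc, act_comp]
  -- Restricting the defining equation leaves the arguments `g ≫ 𝟙 a` and `f ≫ 𝟙`; removing these
  -- identities makes both sides contain the same two restrictions, and only unitor coherence is
  -- left.
  rw [res_congr (Iso.refl (f ≫ dualHom Y)) (ρ_ g), res_congr (ρ_ f) (Iso.refl (g ≫ X))]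
  simp only [Category.assoc, act_comp_assoc, act_comp]
  congr 1
  · congr 1 <;> simp
  congr 1
  congr 1
  · congr 1 <;> simp
  congr 1
  congr 1 <;> simp

lemma slide_comp (f : x ⟶ dualObj c) (X : a ⟶ b) (Y : b ⟶ c) (g : y ⟶ a) :
    (slide f (X ≫ Y) g).hom =
      act (f ◁ (dualComp X Y).hom) (𝟙 g) (dualEv a) ≫
      act (α_ f (dualHom Y) (dualHom X)).inv (𝟙 g) (dualEv a) ≫
      (slide (f ≫ dualHom Y) X g).hom ≫ (slide f Y (g ≫ X)).hom ≫
        act (𝟙 f) (α_ g X Y).hom (dualEv c) := by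
  rw [reassoc_of% act_dualComp_slide, act_comp]
  simp

lemma act_dualComp_slide_inv (f : x ⟶ dualObj c) (X : a ⟶ b) (Y : b ⟶ c) (g : y ⟶ a) :
    act (f ◁ (dualComp X Y).inv) (𝟙 g) (dualEv a) ≫ (slide f (X ≫ Y) g).hom =
      act (α_ f (dualHom Y) (dualHom X)).inv (𝟙 g) (dualEv a) ≫
      (slide (f ≫ dualHom Y) X g).hom ≫ (slide f Y (g ≫ X)).hom ≫
        act (𝟙 f) (α_ g X Y).hom (dualEv c) := by
  rw [slide_comp, act_comp_assoc]
  simp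

/-- The test for equality used for all axioms below. Whiskering with `𝟙 x` brings a 2-cell into the
form `f ◁ _` of the sliding rules, and `θ` is a chain of invertible moves through which both sides
can be pushed. -/
lemma eq_of_act_comp_eq {f g : x ⟶ dualObj a} {α β : f ⟶ g} {t : x ⊠ a ⟶ tUnit B}
    (θ : pull (𝟙 x ≫ g) (𝟙 a) (dualEv a) ⟶ t) [IsIso θ]
    (h : act (𝟙 x ◁ α) (𝟙 (𝟙 a)) (dualEv a) ≫ θ = act (𝟙 x ◁ β) (𝟙 (𝟙 a)) (dualEv a) ≫ θ) :
    α = β :=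
  act_whiskerLeft_injective ((cancel_mono θ).1 h)

/-! ### The 2-functor axioms for `1 ^ (-)` -/

lemma dualHom₂_id (X : a ⟶ b) : dualHom₂ (𝟙 X) = 𝟙 _ := by
  apply eq_of_act_comp_eq (slide _ _ _).hom
  rw [act_dualHom₂_slide]
  simp

lemma dualHom₂_comp {X Y Z : a ⟶ b} (η : X ⟶ Y) (θ : Y ⟶ Z) :
    dualHom₂ (η ≫ θ) = dualHom₂ η ≫ dualHom₂ θ := by
  apply eq_of_act_comp_eq (slide _ _ _).hom
  rw [act_whiskerLeft_comp, Category.assoc]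
  simp only [act_dualHom₂_slide, reassoc_of% act_dualHom₂_slide, act_comp]
  simp

lemma dualHom₂_whiskerLeft (X : a ⟶ b) {Y Y' : b ⟶ c} (η : Y ⟶ Y') :
    dualHom₂ (X ◁ η) = (dualComp X Y).hom ≫ dualHom₂ η ▷ dualHom X ≫ (dualComp X Y').inv := by
  apply eq_of_act_comp_eq (slide _ _ _).hom
  simp only [act_whiskerLeft_comp, Category.assoc]
  rw [act_dualHom₂_slide, act_dualComp_slide_inv, reassoc_of% act_whisker_assoc,
    reassoc_of% slide_natural_left, reassoc_of% act_dualHom₂_slide, slide_comp]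
  simp [act_comp]

lemma dualHom₂_whiskerRight {X X' : a ⟶ b} (η : X ⟶ X') (Y : b ⟶ c) :
    dualHom₂ (η ▷ Y) = (dualComp X Y).hom ≫ dualHom Y ◁ dualHom₂ η ≫ (dualComp X' Y).inv := by
  apply eq_of_act_comp_eq (slide _ _ _).hom
  simp only [act_whiskerLeft_comp, Category.assoc]
  rw [act_dualHom₂_slide, act_dualComp_slide_inv, reassoc_of% act_whiskerLeft_assoc,
    reassoc_of% act_dualHom₂_slide, reassoc_of% slide_natural_right, slide_comp]
  simp [act_comp]

/-- Both sides become the successive slides along `X`, `Y` and `Z`; the remaining 2-cells on the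
arguments agree by coherence in `B`. -/
lemma dualHom₂_associator {d : B} (X : a ⟶ b) (Y : b ⟶ c) (Z : c ⟶ d) :
    dualHom₂ (α_ X Y Z).hom = (dualComp (X ≫ Y) Z).hom ≫ dualHom Z ◁ (dualComp X Y).hom ≫
      (α_ _ _ _).inv ≫ (dualComp Y Z).inv ▷ dualHom X ≫ (dualComp X (Y ≫ Z)).inv := by
  apply eq_of_act_comp_eq (slide _ _ _).hom
  simp only [act_whiskerLeft_comp, Category.assoc]
  rw [act_dualHom₂_slide, act_dualComp_slide_inv, reassoc_of% act_whisker_assoc,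
    reassoc_of% slide_natural_left, reassoc_of% act_dualComp_slide_inv,
    ← reassoc_of% slide_natural_left,
    slide_comp, slide_comp]
  simp only [Category.assoc, reassoc_of% slide_natural_right]
  rw [← reassoc_of% act_whiskerLeft_assoc]
  simp only [act_comp_assoc, act_comp]
  congr 1
  · congr 1
    · bicategory
    · simp
  congr 3
  congr 1
  · simp
  · bicategory

lemma dualHom₂_leftUnitor (X : a ⟶ b) : dualHom₂ (λ_ X).hom =
    (dualComp (𝟙 a) X).hom ≫ dualHom X ◁ (dualId a).hom ≫ (ρ_ _).hom := by
  apply eq_of_act_comp_eq (slide _ _ _).hom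
  simp only [act_whiskerLeft_comp, Category.assoc]
  rw [act_dualHom₂_slide, slide_comp, slide_id, act_eq_left _ (ρ_ _).inv]
  simp only [Category.assoc]
  rw [reassoc_of% slide_natural_right]
  simp only [act_comp_assoc, act_comp]
  -- Appending an identity lets the trailing `act` be compared with `act` of identities, which is a
  -- unitor identity.
  refine Eq.trans ?_ (congrArg _ (Category.comp_id _))
  congr 1
  · congr 1
    simp
  congr 1
  rw [← act_id]
  congr 1
  · simp
  · simp

lemma dualHom₂_rightUnitor (X : a ⟶ b) : dualHom₂ (ρ_ X).hom =
    (dualComp X (𝟙 b)).hom ≫ (dualId b).hom ▷ dualHom X ≫ (λ_ _).hom := by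
  apply eq_of_act_comp_eq (slide _ _ _).hom
  simp only [act_whiskerLeft_comp, Category.assoc]
  rw [act_dualHom₂_slide, slide_comp, slide_id, act_eq_left _ (ρ_ _).inv]
  simp only [Category.assoc]
  rw [← reassoc_of% slide_natural_left]
  simp only [act_comp_assoc, act_comp]
  refine Eq.trans ?_ (congrArg _ (Category.comp_id _))
  congr 1
  · congr 1
    simp
  congr 1
  rw [← act_id]
  congr 1
  · simp
  · simp

variable (B) in
/-- The 2-functor `1 ^ (-)`. -/
noncomputable def dual : B ⥤ᵖ Bᵒᵖ where
  obj a := op (dualObj a)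
  map X := (dualHom X).op
  map₂ η := op2 (dualHom₂ η)
  map₂_id X := congrArg op2 (dualHom₂_id X)
  map₂_comp η θ := congrArg op2 (dualHom₂_comp η θ)
  mapId a := (dualId a).op2
  mapComp X Y := (dualComp X Y).op2
  map₂_whisker_left X _ _ η := congrArg op2 (dualHom₂_whiskerLeft X η)
  map₂_whisker_right η Y := congrArg op2 (dualHom₂_whiskerRight η Y)
  map₂_associator X Y Z := congrArg op2 (dualHom₂_associator X Y Z)
  map₂_left_unitor X := congrArg op2 (dualHom₂_leftUnitor X)
  map₂_right_unitor X := congrArg op2 (dualHom₂_rightUnitor X)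

variable (B) in
/-- The 2-functor `dual B` is `1 ^ (-)`. -/
noncomputable def dualityFunctor : DualityFunctor (dual B) where
  ev := dualEv
  ev_eq _ := rfl
  mapIso := dualHomIso
  mapIso_natural := act_dualHom₂
  mapIso_id a := by
    ext
    exact (act_transposeIso (dualHomIso (𝟙 a))).symm
  mapIso_comp X Y := by
    ext
    refine (dualHomIso_comp X Y).trans ?_
    -- The first action combines `dualComp` with a unitor in the other argument; in the required
    -- pasting these are two separate factors.
    rw [act_eq_left, Category.assoc]
    exact (pasting_hom (tIso (dualComp X Y) (Iso.refl _)) (tIso (Iso.refl _) (λ_ _).symm)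
      (tComp (dualHom Y) (dualHom X) (𝟙 _) (𝟙 _)) (dualHomIso X)
      (tComp (dualHom Y) (𝟙 _) (𝟙 _) X)
      (tIso (ρ_ _ ≪≫ (λ_ _).symm) (λ_ _ ≪≫ (ρ_ _).symm)) (tComp (𝟙 _) (dualHom Y) X (𝟙 _))
      (dualHomIso Y) (tIso (λ_ _).symm (Iso.refl (X ≫ Y))) (tComp (𝟙 _) (𝟙 _) X Y)).symm

end Dual
-- The 2-transformation `η`
section Unit
variable {B : Type u} [Bicategory.{w, v} B] [SymmetricMonoidalBicategory B] [ZeroClosed B]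
  {a b c x y z w : B}

/-- The pairing `a ⊠ 1 ^ a ⟶ 1` obtained from the evaluation by braiding. -/
abbrev coev (a : B) : a ⊠ dualObj a ⟶ tUnit B := flip (dualEv a)

/-- The 1-morphism `a ⟶ 1 ^ (1 ^ a)`. -/
noncomputable def unitHom (a : B) : a ⟶ dualObj (dualObj a) :=
  lift (pull (𝟙 a) (𝟙 (dualObj a)) (coev a))

noncomputable def unitHomIso (a : B) : pull (unitHom a) (𝟙 (dualObj a)) (dualEv (dualObj a)) ≅
    pull (𝟙 a) (𝟙 (dualObj a)) (coev a) :=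
  liftIso _

/-- Removing the unit from the first argument of the evaluation. -/
noncomputable def unitSlide (f : x ⟶ a) (g : y ⟶ dualObj a) :
    pull (f ≫ unitHom a) g (dualEv (dualObj a)) ≅ pull f g (coev a) :=
  actIso (Iso.refl _) (ρ_ g).symm (dualEv (dualObj a)) ≪≫ resIso f g (unitHomIso a) ≪≫
    actIso (ρ_ f) (ρ_ g) (coev a)

lemma unitSlide_natural {f f' : x ⟶ a} {g g' : y ⟶ dualObj a} (α : f ⟶ f') (β : g ⟶ g') :
    act (α ▷ unitHom a) β (dualEv (dualObj a)) ≫ (unitSlide f' g').hom =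
      (unitSlide f g).hom ≫ act α β (coev a) := by
  have h := act_res α β (unitHomIso a).hom
  have h₁ : act (α ▷ unitHom a) β (dualEv _) ≫ act (𝟙 _) (ρ_ g').inv _ =
    act (𝟙 _) (ρ_ g).inv _ ≫ act (α ▷ unitHom a) (β ▷ 𝟙 _) (dualEv _) := by
    simp [act_comp]
  simp only [unitSlide, Iso.trans_hom, actIso_hom, resIso_hom, Iso.refl_hom, Iso.symm_hom,
    Category.assoc]
  rw [reassoc_of% h₁, reassoc_of% h, act_comp, act_comp]
  simp

lemma unitSlide_natural_left {f f' : x ⟶ a} (g : y ⟶ dualObj a) (α : f ⟶ f') :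
    act (α ▷ unitHom a) (𝟙 g) (dualEv (dualObj a)) ≫ (unitSlide f' g).hom =
      (unitSlide f g).hom ≫ act α (𝟙 g) (coev a) :=
  unitSlide_natural α (𝟙 g)

lemma unitSlide_natural_right (f : x ⟶ a) {g g' : y ⟶ dualObj a} (β : g ⟶ g') :
    act (𝟙 _) β (dualEv (dualObj a)) ≫ (unitSlide f g').hom =
      (unitSlide f g).hom ≫ act (𝟙 f) β (coev a) := by
  simpa using unitSlide_natural (𝟙 f) β

lemma unitSlide_congr {f f' : x ⟶ a} {g g' : y ⟶ dualObj a} (α : f ≅ f') (β : g ≅ g') :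
    (unitSlide f g).hom = act (α.hom ▷ unitHom a) β.hom (dualEv (dualObj a)) ≫
      (unitSlide f' g').hom ≫ act α.inv β.inv (coev a) := by
  rw [reassoc_of% unitSlide_natural, act_comp]
  simp

lemma res_unitSlide (r : w ⟶ x) (s : z ⟶ y) (f : x ⟶ a) (g : y ⟶ dualObj a) :
    res r s (unitSlide f g).hom = act (α_ r f (unitHom a)).inv (𝟙 _) (dualEv (dualObj a)) ≫
      (unitSlide (r ≫ f) (s ≫ g)).hom := by
  simp only [unitSlide, Iso.trans_hom, actIso_hom, resIso_hom, Iso.refl_hom, Iso.symm_hom,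
    Category.assoc, res_comp, res_act, res_res, act_comp_assoc, act_comp]
  simp

/-- Moving a 1-morphism from one side of the braided evaluation to the other. -/
noncomputable def coslide (f : x ⟶ dualObj b) (X : a ⟶ b) (g : y ⟶ a) :
    pull g (f ≫ dualHom X) (coev a) ≅ pull (g ≫ X) f (coev b) :=
  flipIso (slide f X g)

lemma coslide_natural {f f' : x ⟶ dualObj b} (X : a ⟶ b) {g g' : y ⟶ a} (α : f ⟶ f')
    (β : g ⟶ g') : act β (α ▷ dualHom X) (coev a) ≫ (coslide f' X g').hom =
      (coslide f X g).hom ≫ act (β ▷ X) α (coev b) := by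
  have h := congrArg flipHom (slide_natural X α β)
  simp only [flipHom_comp, flipHom_act] at h
  exact h

lemma coslide_congr {f f' : x ⟶ dualObj b} (X : a ⟶ b) {g g' : y ⟶ a} (α : f ≅ f')
    (β : g ≅ g') : (coslide f X g).hom = act β.hom (α.hom ▷ dualHom X) (coev a) ≫
      (coslide f' X g').hom ≫ act (β.inv ▷ X) α.inv (coev b) := by
  rw [reassoc_of% coslide_natural, act_comp]
  simp

lemma res_coslide (r : w ⟶ x) (s : z ⟶ y) (f : x ⟶ dualObj b) (X : a ⟶ b) (g : y ⟶ a) :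
    res s r (coslide f X g).hom = act (𝟙 _) (α_ r f (dualHom X)).inv (coev a) ≫
      (coslide (r ≫ f) X (s ≫ g)).hom ≫ act (α_ s g X).hom (𝟙 _) (coev b) := by
  have h := congrArg flipHom (res_slide r s f X g)
  simp only [flipHom_comp, flipHom_act, flipHom_res] at h
  exact h

lemma act_dualHom₂_coslide (f : x ⟶ dualObj b) {X Y : a ⟶ b} (η : X ⟶ Y) (g : y ⟶ a) :
    act (𝟙 g) (f ◁ dualHom₂ η) (coev a) ≫ (coslide f Y g).hom =
      (coslide f X g).hom ≫ act (g ◁ η) (𝟙 f) (coev b) := by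
  have h := congrArg flipHom (act_dualHom₂_slide f η g)
  simp only [flipHom_comp, flipHom_act] at h
  exact h

lemma coslide_id (f : x ⟶ dualObj a) (g : y ⟶ a) : (coslide f (𝟙 a) g).hom =
    act (ρ_ g).inv (f ◁ (dualId a).hom ≫ (ρ_ f).hom) (coev a) := by
  have h := congrArg flipHom (slide_id f g)
  simp only [flipHom_act] at h
  exact h

lemma coslide_comp (f : x ⟶ dualObj c) (X : a ⟶ b) (Y : b ⟶ c) (g : y ⟶ a) :
    (coslide f (X ≫ Y) g).hom =
      act (𝟙 g) (f ◁ (dualComp X Y).hom) (coev a) ≫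
      act (𝟙 g) (α_ f (dualHom Y) (dualHom X)).inv (coev a) ≫
      (coslide (f ≫ dualHom Y) X g).hom ≫ (coslide f Y (g ≫ X)).hom ≫
        act (α_ g X Y).hom (𝟙 f) (coev c) := by
  have h := congrArg flipHom (slide_comp f X Y g)
  simp only [flipHom_comp, flipHom_act] at h
  exact h

/-- The composite with the double dual of a 1-morphism, evaluated. -/
noncomputable def unitNatIso (X : a ⟶ b) :
    pull (unitHom a ≫ dualHom (dualHom X)) (𝟙 (dualObj b)) (dualEv (dualObj b)) ≅
      pull X (𝟙 (dualObj b)) (coev b) :=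
  slide (unitHom a) (dualHom X) (𝟙 _) ≪≫
    actIso (λ_ _).symm (Iso.refl _) _ ≪≫ unitSlide (𝟙 a) (𝟙 _ ≫ dualHom X) ≪≫
    coslide (𝟙 _) X (𝟙 a) ≪≫ actIso (λ_ X) (Iso.refl _) _

/-- The naturality of the unit. -/
noncomputable def unitNat (X : a ⟶ b) : X ≫ unitHom b ≅ unitHom a ≫ dualHom (dualHom X) :=
  transposeIso (unitSlide X (𝟙 _) ≪≫ (unitNatIso X).symm)

lemma act_unitNat (X : a ⟶ b) :
    act (unitNat X).hom (𝟙 (𝟙 _)) (dualEv (dualObj b)) ≫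
      (slide (unitHom a) (dualHom X) (𝟙 _)).hom ≫ act (λ_ _).inv (𝟙 _) _ ≫
        (unitSlide (𝟙 a) (𝟙 _ ≫ dualHom X)).hom ≫ (coslide (𝟙 _) X (𝟙 a)).hom ≫
          act (λ_ X).hom (𝟙 _) _ = (unitSlide X (𝟙 _)).hom := by
  have h : act (unitNat X).hom (𝟙 (𝟙 _)) (dualEv (dualObj b)) ≫ (unitNatIso X).hom =
      (unitSlide X (𝟙 _)).hom := by
    rw [unitNat, act_transposeIso]
    simp
  exact h

/-- The defining equation of `unitNat X` at arbitrary arguments: sliding `dualHom (dualHom X)` to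
the second argument, removing the unit, and sliding `dualHom X` back to the first argument as `X`
agrees with removing the unit after `X`. -/
lemma act_unitNat_slide (g : x ⟶ a) (X : a ⟶ b) (f : y ⟶ dualObj b) :
    act (g ◁ (unitNat X).hom) (𝟙 f) (dualEv (dualObj b)) ≫
      act (α_ g (unitHom a) (dualHom (dualHom X))).inv (𝟙 f) (dualEv (dualObj b)) ≫
      (slide (g ≫ unitHom a) (dualHom X) f).hom ≫ (unitSlide g (f ≫ dualHom X)).hom ≫
        (coslide f X g).hom =
      act (α_ g X (unitHom b)).inv (𝟙 f) (dualEv (dualObj b)) ≫ (unitSlide (g ≫ X) f).hom := by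
  have h := congrArg (res g f) (act_unitNat X)
  simp only [res_comp, res_act, res_slide, res_unitSlide, res_coslide] at h
  -- Restriction along `g` and `f` produces arguments composed with identities; each move is
  -- transported to the arguments without them.
  rw [slide_congr (dualHom X) (Iso.refl (g ≫ unitHom a)) (ρ_ f),
    unitSlide_congr (ρ_ g) (whiskerLeftIso f (λ_ (dualHom X))), coslide_congr X (ρ_ f) (ρ_ g),
    unitSlide_congr (Iso.refl (g ≫ X)) (ρ_ f)] at h
  have h := act (𝟙 _) (ρ_ f).inv _ ≫= h =≫ act (𝟙 _) (ρ_ f).hom _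
  simp only [Category.assoc, act_comp_assoc, act_comp] at h
  simp at h
  simpa [act_comp_assoc] using h

lemma slide_unitSlide_coslide (g : x ⟶ a) (X : a ⟶ b) (f : y ⟶ dualObj b) :
    (slide (g ≫ unitHom a) (dualHom X) f).hom ≫ (unitSlide g (f ≫ dualHom X)).hom ≫
        (coslide f X g).hom =
      act ((α_ _ _ _).hom ≫ g ◁ (unitNat X).inv ≫ (α_ _ _ _).inv) (𝟙 f) _ ≫
        (unitSlide (g ≫ X) f).hom := by
  have h := act ((α_ _ _ _).hom ≫ g ◁ (unitNat X).inv) (𝟙 f) _ ≫= act_unitNat_slide g X f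
  simp only [act_comp_assoc] at h
  simpa using h

/-- The 2-cell `η` travels along the chain of moves: the slide turns its double dual on the first
argument into a single dual on the second, and the coslide turns that into `η` itself on the first.
-/
lemma unitNat_natural {X Y : a ⟶ b} (η : X ⟶ Y) :
    η ▷ unitHom b ≫ (unitNat Y).hom =
      (unitNat X).hom ≫ unitHom a ◁ dualHom₂ (dualHom₂ η) := by
  apply eq_of_act_comp_eq (act (α_ _ _ _).inv (𝟙 _) _ ≫
    (slide (𝟙 a ≫ unitHom a) (dualHom Y) (𝟙 _)).hom ≫ (unitSlide (𝟙 a) (𝟙 _ ≫ dualHom Y)).hom ≫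
      (coslide (𝟙 _) Y (𝟙 a)).hom)
  simp only [act_whiskerLeft_comp, Category.assoc]
  rw [act_unitNat_slide, reassoc_of% act_whisker_assoc, unitSlide_natural_left,
    reassoc_of% act_whiskerLeft_assoc, reassoc_of% act_dualHom₂_slide,
    reassoc_of% unitSlide_natural_right,
    act_dualHom₂_coslide, reassoc_of% act_unitNat_slide]

lemma unitNat_id (a : B) :
    (unitNat (𝟙 a)).hom ≫ unitHom a ◁ (dualHom₂ (dualId a).hom ≫ (dualId (dualObj a)).hom) =
      (λ_ (unitHom a)).hom ≫ (ρ_ (unitHom a)).inv := by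
  -- The test map ends in `unitSlide` at `𝟙 a ≫ 𝟙 a`, since that is where `act_unitNat_slide` for
  -- the identity ends. On its other side, `coslide_id` and `slide_id` turn both slides into
  -- `dualId`.
  apply eq_of_act_comp_eq (act (𝟙 _ ◁ (ρ_ _).hom) (𝟙 _) _ ≫
    act ((ρ_ (𝟙 a)).inv ▷ unitHom a) (𝟙 _) _ ≫ (unitSlide (𝟙 a ≫ 𝟙 a) (𝟙 _)).hom)
  have h := act_unitNat_slide (𝟙 a) (𝟙 a) (𝟙 _)
  have e : act ((ρ_ (𝟙 a)).inv ▷ unitHom a) (𝟙 _ ◁ (dualId a).hom ≫ (ρ_ _).hom)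
      (dualEv (dualObj a)) = act (𝟙 _) (𝟙 _ ◁ (dualId a).hom) _ ≫
        act ((ρ_ (𝟙 a)).inv ▷ unitHom a) (ρ_ _).hom _ := by
    simp [act_comp]
  rw [coslide_id, ← unitSlide_natural, e, Category.assoc, ← reassoc_of% act_dualHom₂_slide,
    slide_id] at h
  simp only [act_comp_assoc] at h ⊢
  refine Eq.trans ?_ (h.trans ?_)
  · congr 2
    · simp
    · simp
  · congr 2
    · bicategory
    · simp

/-- One chain of moves for `X ≫ Y` is compared with two nested chains. Splitting `slide` and
`coslide` along composites makes the chain for `X` sit inside the one for `Y`, and each is absorbed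
by its own `unitNat`. -/
lemma unitNat_comp (X : a ⟶ b) (Y : b ⟶ c) :
    (unitNat (X ≫ Y)).hom ≫ unitHom a ◁ (dualHom₂ (dualComp X Y).hom ≫
        (dualComp (dualHom Y) (dualHom X)).hom) =
      (α_ _ _ _).hom ≫ X ◁ (unitNat Y).hom ≫ (α_ _ _ _).inv ≫
        (unitNat X).hom ▷ dualHom (dualHom Y) ≫ (α_ _ _ _).hom := by
  apply eq_of_act_comp_eq (act (𝟙 a ◁ (α_ _ _ _).inv) (𝟙 _) _ ≫ act (α_ _ _ _).inv (𝟙 _) _ ≫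
    (slide (𝟙 a ≫ unitHom a ≫ dualHom (dualHom X)) (dualHom Y) (𝟙 _)).hom ≫
    act (α_ _ _ _).inv (𝟙 _) _ ≫ (slide (𝟙 a ≫ unitHom a) (dualHom X) (𝟙 _ ≫ dualHom Y)).hom ≫
    (unitSlide (𝟙 a) ((𝟙 _ ≫ dualHom Y) ≫ dualHom X)).hom ≫
      (coslide (𝟙 _ ≫ dualHom Y) X (𝟙 a)).hom ≫ (coslide (𝟙 _) Y (𝟙 a ≫ X)).hom)
  have h : act (𝟙 a ◁ ((unitNat X).hom ▷ dualHom (dualHom Y) ≫ (α_ _ _ _).hom)) (𝟙 (𝟙 _)) _ ≫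
      act (𝟙 a ◁ (α_ _ _ _).inv) (𝟙 _) _ ≫ act (α_ _ _ _).inv (𝟙 _) _ ≫
      (slide (𝟙 a ≫ unitHom a ≫ dualHom (dualHom X)) (dualHom Y) (𝟙 _)).hom =
      act (α_ _ _ _).inv (𝟙 _) _ ≫ (slide (𝟙 a ≫ X ≫ unitHom b) (dualHom Y) (𝟙 _)).hom ≫
        act (𝟙 a ◁ (unitNat X).hom) (𝟙 _) _ := by
    rw [← slide_natural_left, act_comp_assoc, act_comp_assoc, act_comp_assoc]
    simp
  have h' := act_unitNat_slide (𝟙 a) (X ≫ Y) (𝟙 _)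
  rw [coslide_comp, ← reassoc_of% unitSlide_natural_right, ← reassoc_of% unitSlide_natural_right,
    ← reassoc_of% act_dualHom₂_slide, slide_comp,
    unitSlide_congr (α_ (𝟙 a) X Y).symm (Iso.refl _)] at h'
  simp only [Category.assoc] at h'
  have h' := h' =≫ act (α_ (𝟙 a) X Y).inv (𝟙 (𝟙 _)) _
  simp only [act_whiskerLeft_comp, Category.assoc] at h ⊢
  rw [reassoc_of% h, reassoc_of% act_unitNat_slide, ← reassoc_of% slide_natural_left,
    ← reassoc_of% slide_natural_left, slide_unitSlide_coslide (𝟙 a ≫ X) Y (𝟙 _)]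
  simp only [Category.assoc, act_comp_assoc, act_comp] at h' ⊢
  refine Eq.trans ?_ (h'.trans ?_)
  · congr 1
    · congr 1
      bicategory
    congr 2
    simp
  have e : act ((α_ (𝟙 a) X Y).symm.inv ≫ (α_ (𝟙 a) X Y).inv)
      ((Iso.refl (𝟙 (dualObj c))).inv ≫ 𝟙 (𝟙 (dualObj c))) (coev c) = 𝟙 _ := by
    simp
  rw [e, Category.comp_id]
  congr 2
  · simp
    bicategory
  · simp

variable (B) in
/-- The 2-transformation `id ⟶ 1 ^ (1 ^ (-))`. -/
noncomputable def unitTrans :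
    (Pseudofunctor.id B).StrongTrans ((dual B).comp (opToCov (dual B))) where
  app := unitHom
  naturality X := unitNat X
  naturality_naturality η := unitNat_natural η
  naturality_id a := (unitNat_id a).trans
    ((congrArg (· ≫ _) (id_whiskerRight _ _)).trans (Category.id_comp _)).symm
  naturality_comp X Y := (unitNat_comp X Y).trans
    ((congrArg (· ≫ _) (id_whiskerRight _ _)).trans (Category.id_comp _)).symm

end Unit
-- The modification `τ` and its coherence
section Triangle
variable {B : Type u} [Bicategory.{w, v} B] [SymmetricMonoidalBicategory B] [ZeroClosed B]
  {a b c x y z w : B}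

/-- Removing the unit from the second argument of the braided evaluation. -/
noncomputable def counitSlide (f : x ⟶ dualObj a) (g : y ⟶ a) :
    pull f (g ≫ unitHom a) (coev (dualObj a)) ≅ pull f g (dualEv a) :=
  flipIso (unitSlide g f) ≪≫ syl f g (dualEv a)

lemma counitSlide_natural {f f' : x ⟶ dualObj a} {g g' : y ⟶ a} (α : f ⟶ f') (β : g ⟶ g') :
    act α (β ▷ unitHom a) (coev (dualObj a)) ≫ (counitSlide f' g').hom =
      (counitSlide f g).hom ≫ act α β (dualEv a) := by
  have h := congrArg flipHom (unitSlide_natural β α)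
  simp only [flipHom_comp, flipHom_act] at h
  have h' := flipHom_flipHom_syl (act α β (dualEv a))
  simp only [flipHom_act] at h'
  simp only [counitSlide, Iso.trans_hom, flipIso_hom, Category.assoc, ← h']
  exact (reassoc_of% h) _

lemma counitSlide_congr {f f' : x ⟶ dualObj a} {g g' : y ⟶ a} (α : f ≅ f') (β : g ≅ g') :
    (counitSlide f g).hom = act α.hom (β.hom ▷ unitHom a) (coev (dualObj a)) ≫
      (counitSlide f' g').hom ≫ act α.inv β.inv (dualEv a) := by
  rw [reassoc_of% counitSlide_natural, act_comp]
  simp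

lemma res_counitSlide (r : w ⟶ x) (s : z ⟶ y) (f : x ⟶ dualObj a) (g : y ⟶ a) :
    res r s (counitSlide f g).hom = act (𝟙 _) (α_ s g (unitHom a)).inv (coev (dualObj a)) ≫
      (counitSlide (r ≫ f) (s ≫ g)).hom := by
  have h := congrArg flipHom (res_unitSlide s r g f)
  simp only [flipHom_comp, flipHom_act, flipHom_res] at h
  simp only [counitSlide, Iso.trans_hom, flipIso_hom, res_comp, res_syl]
  exact (congrArg (· ≫ _) h).trans (Category.assoc _ _ _)

/-- Removing the two units from `⟨η g, η f⟩` gives the same result in either order, up to braiding.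
By the symmetry axiom (`flipHom_syl`) the flipped syllepsis is again a syllepsis, which then passes
`unitSlide` by naturality. -/
lemma flipHom_unitSlide_counitSlide (f : x ⟶ a) (g : y ⟶ dualObj a) :
    flipHom (unitSlide g (f ≫ unitHom a)).hom ≫ flipHom (counitSlide g f).hom =
      (counitSlide (f ≫ unitHom a) g).hom ≫ (unitSlide f g).hom := by
  simp only [counitSlide, Iso.trans_hom, flipIso_hom, flipHom_comp, flipHom_syl, Category.assoc]
  rw [flipHom_flipHom_syl]

/-- The braided form of `slide_unitSlide_coslide`. Flipping makes the last `coslide` a doubly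
flipped `slide`, and the syllepsis undoes the double flip. -/
lemma coslide_counitSlide_slide (f : x ⟶ dualObj b) (X : a ⟶ b) (g : y ⟶ a) :
    (coslide (g ≫ unitHom a) (dualHom X) f).hom ≫ (counitSlide (f ≫ dualHom X) g).hom ≫
        (slide f X g).hom =
      act (𝟙 f) ((α_ _ _ _).hom ≫ g ◁ (unitNat X).inv ≫ (α_ _ _ _).inv) _ ≫
        (counitSlide f (g ≫ X)).hom := by
  have h := congrArg flipHom (slide_unitSlide_coslide g X f)
  simp only [flipHom_comp, flipHom_act] at h
  have h := h =≫ (syl f (g ≫ X) (dualEv b)).hom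
  simp only [Category.assoc] at h
  simp only [counitSlide, Iso.trans_hom, flipIso_hom, Category.assoc, ← flipHom_flipHom_syl]
  exact h

/-- The triangle 2-isomorphism. -/
noncomputable def triangle (a : B) :
    unitHom (dualObj a) ≫ dualHom (unitHom a) ≅ 𝟙 (dualObj a) :=
  transposeIso (slide (unitHom (dualObj a)) (unitHom a) (𝟙 a) ≪≫
    actIso (λ_ _).symm (Iso.refl _) _ ≪≫ unitSlide (𝟙 _) (𝟙 a ≫ unitHom a) ≪≫
      counitSlide (𝟙 _) (𝟙 a))

/-- The defining equation of `triangle a` at arbitrary arguments, obtained by restriction and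
removal of unitors. -/
lemma act_triangle (f : x ⟶ dualObj a) (g : y ⟶ a) :
    act (f ◁ (triangle a).hom ≫ (ρ_ f).hom) (𝟙 g) (dualEv a) =
      act (α_ _ _ _).inv (𝟙 g) (dualEv a) ≫
        (slide (f ≫ unitHom (dualObj a)) (unitHom a) g).hom ≫
          (unitSlide f (g ≫ unitHom a)).hom ≫ (counitSlide f g).hom := by
  have h := congrArg (res f g) (act_transposeIso (slide (unitHom (dualObj a)) (unitHom a) (𝟙 a) ≪≫
    actIso (λ_ _).symm (Iso.refl _) _ ≪≫ unitSlide (𝟙 _) (𝟙 a ≫ unitHom a) ≪≫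
      counitSlide (𝟙 _) (𝟙 a)))
  simp only [Iso.trans_hom, actIso_hom, res_comp, res_act, res_slide, res_unitSlide,
    res_counitSlide] at h
  rw [slide_congr (unitHom a) (Iso.refl (f ≫ unitHom (dualObj a))) (ρ_ g),
    unitSlide_congr (ρ_ f) (whiskerLeftIso g (λ_ (unitHom a))),
    counitSlide_congr (ρ_ f) (ρ_ g)] at h
  have h := act (𝟙 _) (ρ_ g).inv _ ≫= h =≫ act (ρ_ f).hom (ρ_ g).hom _
  simp only [Category.assoc, act_comp_assoc, act_comp] at h
  simp at h
  simpa [triangle] using h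

/-- Evaluates the second half of the naturality square for `τ`, namely `d` applied to the naturality
of `η`: after sliding, it is the inverse of `unitNat X` acting on the second argument. -/
lemma act_slide_slide_unitNat (f : x ⟶ dualObj (dualObj (dualObj b))) (X : a ⟶ b) (g : y ⟶ a) :
    act (f ◁ ((dualComp (unitHom a) (dualHom (dualHom X))).inv ≫ dualHom₂ (unitNat X).inv ≫
        (dualComp X (unitHom b)).hom)) (𝟙 g) (dualEv a) ≫ act (α_ _ _ _).inv (𝟙 g) (dualEv a) ≫
      (slide (f ≫ dualHom (unitHom b)) X g).hom ≫ (slide f (unitHom b) (g ≫ X)).hom =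
    act (α_ _ _ _).inv (𝟙 g) (dualEv a) ≫
      (slide (f ≫ dualHom (dualHom (dualHom X))) (unitHom a) g).hom ≫
      (slide f (dualHom (dualHom X)) (g ≫ unitHom a)).hom ≫
        act (𝟙 f) ((α_ _ _ _).hom ≫ g ◁ (unitNat X).inv ≫ (α_ _ _ _).inv) _ := by
  simp only [act_whiskerLeft_comp, Category.assoc]
  refine (_ ≫= _ ≫= act_dualComp_slide f X (unitHom b) g).trans ?_
  refine (_ ≫= (reassoc_of% (act_dualHom₂_slide f (unitNat X).inv g)) _).trans ?_
  refine ((reassoc_of% (act_dualComp_slide_inv f (unitHom a) (dualHom (dualHom X)) g)) _).trans ?_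
  simp only [act_comp, Category.comp_id]

/-- Both triangles are expanded into moves. The naturality of `η` at `X` is absorbed by
`coslide_counitSlide_slide`, and the one at `dualHom X` cancels against `slide_unitSlide_coslide`;
the same slides remain on both sides. -/
lemma act_triangle_natural (f : x ⟶ dualObj b) (X : a ⟶ b) (g : y ⟶ a) :
    act (f ◁ (dualHom X ◁ (triangle a).hom ≫ (ρ_ _).hom ≫ (λ_ _).inv)) (𝟙 g) (dualEv a) ≫
      act (α_ _ _ _).inv (𝟙 g) _ ≫ (slide (f ≫ 𝟙 _) X g).hom ≫ act (ρ_ f).hom (𝟙 _) _ =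
    act (f ◁ (((α_ _ _ _).inv ≫ (unitNat (dualHom X)).hom ▷ dualHom (unitHom a) ≫ (α_ _ _ _).hom ≫
      unitHom (dualObj b) ◁ ((dualComp (unitHom a) (dualHom (dualHom X))).inv ≫
        dualHom₂ (unitNat X).inv ≫ (dualComp X (unitHom b)).hom) ≫ (α_ _ _ _).inv) ≫
          (triangle b).hom ▷ dualHom X)) (𝟙 g) (dualEv a) ≫
      act (α_ _ _ _).inv (𝟙 g) _ ≫ (slide (f ≫ 𝟙 _) X g).hom ≫ act (ρ_ f).hom (𝟙 _) _ := by
  simp only [act_whiskerLeft_comp, Category.assoc]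
  have e : act (f ◁ (λ_ (dualHom X)).inv) (𝟙 g) (dualEv a) ≫ act (α_ _ _ _).inv (𝟙 g) _ ≫
      (slide (f ≫ 𝟙 _) X g).hom ≫ act (ρ_ f).hom (𝟙 _) _ = (slide f X g).hom := by
    rw [← slide_natural_left, act_comp_assoc, act_comp_assoc]
    simp
  have t : act (f ◁ dualHom X ◁ (triangle a).hom) (𝟙 g) (dualEv a) ≫
      act (f ◁ (ρ_ (dualHom X)).hom) (𝟙 g) (dualEv a) =
      act (α_ _ _ _).inv (𝟙 g) _ ≫
        act ((f ≫ dualHom X) ◁ (triangle a).hom ≫ (ρ_ _).hom) (𝟙 g) _ := by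
    simp [act_comp]
  rw [e, reassoc_of% t, act_triangle]
  simp only [Category.assoc]
  have t' : act ((f ◁ (triangle b).hom)) (𝟙 (g ≫ X)) (dualEv b) ≫ act (ρ_ f).hom (𝟙 _) _ =
      act (f ◁ (triangle b).hom ≫ (ρ_ f).hom) (𝟙 (g ≫ X)) _ := by
    simp [act_comp]
  rw [reassoc_of% act_whisker_assoc, reassoc_of% slide_natural_left, t', act_triangle,
    ← reassoc_of% slide_natural_left]
  have h := act_slide_slide_unitNat (f ≫ unitHom (dualObj b)) X g
  have h₁ := slide_unitSlide_coslide f (dualHom X) (g ≫ unitHom a)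
  have h₂ := coslide_counitSlide_slide f X g
  have t'' : act (f ◁ unitHom (dualObj b) ◁
      ((dualComp (unitHom a) (dualHom (dualHom X))).inv ≫
        dualHom₂ (unitNat X).inv ≫ (dualComp X (unitHom b)).hom)) (𝟙 g) (dualEv a) ≫
      act (f ◁ (α_ (unitHom (dualObj b)) (dualHom (unitHom b)) (dualHom X)).inv) (𝟙 g) _ ≫
        act (α_ f (unitHom (dualObj b) ≫ dualHom (unitHom b)) (dualHom X)).inv (𝟙 g) _ ≫
          act ((α_ f (unitHom (dualObj b)) (dualHom (unitHom b))).inv ▷ dualHom X) (𝟙 g) _ =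
      act (α_ _ _ _).inv (𝟙 g) _ ≫ act ((f ≫ unitHom (dualObj b)) ◁
      ((dualComp (unitHom a) (dualHom (dualHom X))).inv ≫
        dualHom₂ (unitNat X).inv ≫ (dualComp X (unitHom b)).hom)) (𝟙 g) (dualEv a) ≫
          act (α_ _ _ _).inv (𝟙 g) _ := by
    -- The identity holds for any 2-cell `m` in this position, by naturality of associators alone.
    generalize (dualComp (unitHom a) (dualHom (dualHom X))).inv ≫
        dualHom₂ (unitNat X).inv ≫ (dualComp X (unitHom b)).hom = m
    simp only [act_comp]
    congr 1
    · bicategory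
    · simp
  rw [reassoc_of% t'', reassoc_of% h, reassoc_of% unitSlide_natural_right, ← h₂, reassoc_of% h₁,
    ← reassoc_of% slide_natural_left]
  simp only [act_comp_assoc]
  congr 2
  · simp
  · simp

/-- On one side, sliding moves `d (τ a)` to the second argument as `triangle a`, which is expanded
there through the braiding; on the other, `triangle (dualObj a)` is expanded on the first. The two
expansions remove two units in opposite orders, and `slide_unitSlide_coslide` supplies the
naturality 2-cell of `η` between them. -/
lemma act_triangle_coherent (f : x ⟶ a) (g : y ⟶ dualObj a) :
    act (f ◁ unitHom a ◁ ((dualComp (unitHom (dualObj a)) (dualHom (unitHom a))).inv ≫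
        dualHom₂ (triangle a).hom ≫ (dualId (dualObj a)).hom)) (𝟙 g) (dualEv (dualObj a)) ≫
      act (f ◁ (ρ_ (unitHom a)).hom) (𝟙 g) _ ≫ (unitSlide f g).hom =
    act (f ◁ ((α_ _ _ _).inv ≫ (unitNat (unitHom a)).inv ▷ dualHom (unitHom (dualObj a)) ≫
        (α_ _ _ _).hom ≫ unitHom a ◁ (triangle (dualObj a)).hom)) (𝟙 g) (dualEv (dualObj a)) ≫
      act (f ◁ (ρ_ (unitHom a)).hom) (𝟙 g) _ ≫ (unitSlide f g).hom := by
  simp only [act_whiskerLeft_comp, Category.assoc]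
  have h₁ := slide_unitSlide_coslide f (unitHom a) (g ≫ unitHom (dualObj a))
  -- Here `triangle a` has to act on the second argument of a braided evaluation, so its equation is
  -- flipped; the symmetry axiom enters in the `simp only` that follows.
  have h₂ := congrArg flipHom (act_triangle g f)
  simp only [flipHom_comp, flipHom_act, flipHom_unitSlide_counitSlide] at h₂
  have h₃ : act (𝟙 (f ≫ unitHom a)) (g ◁ (triangle a).hom ≫ (ρ_ g).hom)
      (dualEv (dualObj a)) ≫ (unitSlide f g).hom = (unitSlide f _).hom ≫ _ :=
    (unitSlide_natural_right f (g ◁ (triangle a).hom ≫ (ρ_ g).hom)).trans (_ ≫= h₂)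
  have l : act ((f ≫ unitHom a) ◁ ((dualComp (unitHom (dualObj a)) (dualHom (unitHom a))).inv ≫
        dualHom₂ (triangle a).hom ≫ (dualId (dualObj a)).hom) ≫ (ρ_ _).hom) (𝟙 g)
          (dualEv (dualObj a)) =
      act (α_ _ _ _).inv (𝟙 g) _ ≫ (slide _ (unitHom (dualObj a)) g).hom ≫
        (slide (f ≫ unitHom a) (dualHom (unitHom a)) (g ≫ unitHom (dualObj a))).hom ≫
          act (𝟙 _) (α_ _ _ _).hom _ ≫ act (𝟙 _) (g ◁ (triangle a).hom ≫ (ρ_ g).hom) _ := by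
    have h := (reassoc_of% (act_dualComp_slide_inv (f ≫ unitHom a) (unitHom (dualObj a))
      (dualHom (unitHom a)) g)) (act (𝟙 _) (g ◁ (triangle a).hom ≫ (ρ_ g).hom) _)
    refine Eq.trans ?_ h
    have h := act_dualHom₂_slide (f ≫ unitHom a) (triangle a).hom g
    rw [slide_id] at h
    have h := h =≫ act (𝟙 _) (ρ_ g).hom _
    simp only [Category.assoc, act_comp, Category.comp_id, Category.id_comp,
      Iso.inv_hom_id] at h
    rw [← h, act_comp]
    simp
  have l' : act (f ◁ unitHom a ◁ ((dualComp (unitHom (dualObj a)) (dualHom (unitHom a))).inv ≫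
        dualHom₂ (triangle a).hom ≫ (dualId (dualObj a)).hom)) (𝟙 g) (dualEv (dualObj a)) ≫
      act (f ◁ (ρ_ (unitHom a)).hom) (𝟙 g) (dualEv (dualObj a)) =
      act (α_ _ _ _).inv (𝟙 g) _ ≫
        act ((f ≫ unitHom a) ◁ ((dualComp (unitHom (dualObj a)) (dualHom (unitHom a))).inv ≫
        dualHom₂ (triangle a).hom ≫ (dualId (dualObj a)).hom) ≫ (ρ_ _).hom) (𝟙 g) _ := by
    simp [act_comp]
  have r : act (f ◁ unitHom a ◁ (triangle (dualObj a)).hom) (𝟙 g) (dualEv (dualObj a)) ≫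
      act (f ◁ (ρ_ (unitHom a)).hom) (𝟙 g) (dualEv (dualObj a)) =
      act (α_ _ _ _).inv (𝟙 g) _ ≫
        act ((f ≫ unitHom a) ◁ (triangle (dualObj a)).hom ≫ (ρ_ _).hom) (𝟙 g) _ := by
    simp [act_comp]
  have h₄ : act (𝟙 (f ≫ unitHom a)) (α_ g (unitHom (dualObj a)) (dualHom (unitHom a))).hom
      (dualEv (dualObj a)) ≫ (unitSlide f _).hom ≫
        act (𝟙 f) (α_ g (unitHom (dualObj a)) (dualHom (unitHom a))).inv (coev a) =
      (unitSlide f _).hom := by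
    rw [reassoc_of% unitSlide_natural_right, act_comp]
    simp
  rw [reassoc_of% l', l, reassoc_of% r, act_triangle]
  simp only [Category.assoc]
  rw [h₃, reassoc_of% h₄]
  refine (_ ≫= _ ≫= _ ≫= (reassoc_of% h₁) _).trans ?_
  rw [← reassoc_of% slide_natural_left]
  simp only [act_comp_assoc]
  congr 2
  · simp
  · simp

lemma triangle_natural (X : a ⟶ b) :
    IsModificationAt
      (sqComp (unitNat (dualHom X)) ((dualComp (unitHom a) (dualHom (dualHom X))).symm ≪≫
        { hom := dualHom₂ (unitNat X).inv
          inv := dualHom₂ (unitNat X).hom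
          hom_inv_id := by rw [← dualHom₂_comp, Iso.inv_hom_id, dualHom₂_id]
          inv_hom_id := by rw [← dualHom₂_comp, Iso.hom_inv_id, dualHom₂_id] } ≪≫
          dualComp X (unitHom b)))
      (sqId (dualHom X)) (triangle b) (triangle a) := by
  simp only [IsModificationAt, sqComp, sqId, Iso.trans_hom, Iso.symm_hom, whiskerRightIso_hom,
    whiskerLeftIso_hom]
  exact eq_of_act_comp_eq _ (act_triangle_natural (𝟙 _) X (𝟙 a))

lemma triangle_coherent (a : B) :
    unitHom a ◁ ((dualComp (unitHom (dualObj a)) (dualHom (unitHom a))).inv ≫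
        dualHom₂ (triangle a).hom ≫ (dualId (dualObj a)).hom) =
      (α_ _ _ _).inv ≫ (unitNat (unitHom a)).inv ▷ dualHom (unitHom (dualObj a)) ≫
        (α_ _ _ _).hom ≫ unitHom a ◁ (triangle (dualObj a)).hom :=
  eq_of_act_comp_eq (act (𝟙 a ◁ (ρ_ (unitHom a)).hom) (𝟙 (𝟙 _)) (dualEv (dualObj a)) ≫
    (unitSlide (𝟙 a) (𝟙 _)).hom) (act_triangle_coherent (𝟙 a) (𝟙 _))

variable (B) in
/-- The lax volutive structure given by duality. -/
noncomputable def dualStructure : LaxVolutiveStructure B where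
  d := dual B
  η := unitTrans B
  τ := triangle
  τ_natural X := triangle_natural X
  coherence a := by
    ext
    exact triangle_coherent a

end Triangle
end LaxVolutive

theorem mainTheorem7 {B : Type u} [Bicategory.{w, v} B]
    [LaxVolutive.SymmetricMonoidalBicategory B] [LaxVolutive.ZeroClosed B] :
    ∃ (V : LaxVolutive.LaxVolutiveStructure B) (D : LaxVolutive.DualityFunctor V.d),
      ∀ a : B, Nonempty
        (LaxVolutive.wr (V.η.app a) (V.d.obj a).unop ≫ D.ev (V.d.obj a).unop ≅
          LaxVolutive.br a (V.d.obj a).unop ≫ D.ev a) :=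
  ⟨LaxVolutive.dualStructure B, LaxVolutive.dualityFunctor B, fun a =>
    -- The pairing lifted to define `η` is the braided evaluation pulled back along `𝟙 ⊠₁ 𝟙`; the
    -- last two factors remove that identity.
    ⟨LaxVolutive.unitHomIso a ≪≫ whiskerRightIso (LaxVolutive.tId a (LaxVolutive.dualObj a)) _ ≪≫
      λ_ _⟩⟩
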